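/- For an integer $n\ge 2$ and $x\in[-1+\tfrac2n,1]$ put \[ \Phi_n(x)=-1-\frac{4}{n^2}+\frac{3}{n}+\frac{3x}{n}-\frac{n-2}{\sqrt2\,n^2\sqrt{n-1}}\,(n-2+nx)^{3/2}, \] and define $\Phi:[-1,1]\to[-1,1]$ by $\Phi(-1)=-1$ and $\Phi(x)=\Phi_n(x)$ if $x\in\big[\tfrac{2-n}{n},\tfrac{2-(n-1)}{n-1}\big]$ for some $n\ge2$ (these intervals cover $(-1,1]$, and the formulas agree at common endpoints). Let $X,Y$ be real random variables on a common probability space whose distribution functions $F,G$ are continuous. Let $\rho(X,Y)$ (Spearman's $\rho$) be the Pearson correlation coefficient of $F(X)$ and $G(Y)$, and let \[ \tau(X,Y)=\mathbb P\big((X_1-X_2)(Y_1-Y_2)>0\big)-\mathbb P\big((X_1-X_2)(Y_1-Y_2)<0\big) \] (Kendall's $\tau$), where $(X_1,Y_1)$ and $(X_2,Y_2)$ are independent and distributed as $(X,Y)$. If $\tau(X,Y)=\tau_0$, then \[ \rho(X,Y)\in[\Phi(\tau_0),\,-\Phi(-\tau_0)]. \] These bounds are sharp: for every $\tau_0\in[-1,1]$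 there are random variables $X,Y$ with continuous distribution functions such that $\tau(X,Y)=\tau_0$ and $\rho(X,Y)=\Phi(\tau_0)$, and there are such $X,Y$ with $\tau(X,Y)=\tau_0$ and $\rho(X,Y)=-\Phi(-\tau_0)$. -/

import Mathlib

open MeasureTheory ProbabilityTheory

noncomputable section

/-- `X` is a continuous random variable on the probability space `(Ω, P)`: it is measurable and
its distribution function is continuous. -/
def IsContinuousRV {Ω : Type*} [MeasurableSpace Ω] (P : Measure Ω) (X : Ω → ℝ) : Prop :=
  Measurable X ∧ Continuous (cdf (P.map X))

/-- The Pearson correlation coefficient of `U` and `V`. -/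
def pearsonCorr {Ω : Type*} [MeasurableSpace Ω] (P : Measure Ω) (U V : Ω → ℝ) : ℝ :=
  covariance U V P / (√(variance U P) * √(variance V P))

/-- Spearman's `ρ`: the Pearson correlation coefficient of `F ∘ X` and `G ∘ Y`, where `F` and `G`
are the distribution functions of `X` and `Y`. -/
def spearmanRho {Ω : Type*} [MeasurableSpace Ω] (P : Measure Ω) (X Y : Ω → ℝ) : ℝ :=
  pearsonCorr P (fun ω => cdf (P.map X) (X ω)) (fun ω => cdf (P.map Y) (Y ω))

/-- Kendall's `τ`: the probability of concordance minus the probability of discordance of two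
independent copies of `(X, Y)`. On the product space `(Ω × Ω, P ⊗ P)` the pairs
`(X p.1, Y p.1)` and `(X p.2, Y p.2)` are such copies. -/
def kendallTau {Ω : Type*} [MeasurableSpace Ω] (P : Measure Ω) (X Y : Ω → ℝ) : ℝ :=
  (P.prod P).real {p | (X p.1 - X p.2) * (Y p.1 - Y p.2) > 0} -
    (P.prod P).real {p | (X p.1 - X p.2) * (Y p.1 - Y p.2) < 0}

/-- The functions `Φ_n`, used for `n ≥ 2` and `x ≥ -1 + 2 / n`. -/
def PhiAux (n : ℕ) (x : ℝ) : ℝ :=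
  -1 - 4 / (n : ℝ) ^ 2 + 3 / (n : ℝ) + 3 * x / (n : ℝ) -
    ((n : ℝ) - 2) / (√2 * (n : ℝ) ^ 2 * √((n : ℝ) - 1)) *
      ((n : ℝ) - 2 + (n : ℝ) * x) ^ (3 / 2 : ℝ)

/-- `x` lies in the `n`-th interval `[(2 - n) / n, (2 - (n - 1)) / (n - 1)]`, where `n ≥ 2`. -/
def PhiPiece (n : ℕ) (x : ℝ) : Prop :=
  2 ≤ n ∧ x ∈ Set.Icc ((2 - (n : ℝ)) / n) ((2 - ((n : ℝ) - 1)) / ((n : ℝ) - 1))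

open Classical in
/-- The function `Φ` on `[-1, 1]`: it equals `Φ_n` on the `n`-th interval, and `Φ (-1) = -1`.
The intervals cover `(-1, 1]`; neighbouring ones share an endpoint, at which the two formulas
agree, so the choice of the smallest admissible `n` is immaterial. -/
def Phi (x : ℝ) : ℝ :=
  if h : ∃ n : ℕ, PhiPiece n x then PhiAux (Nat.find h) x else -1

end


/-!
Let `p` be the probability that two independent copies of `(X, Y)` are concordant, and `t` the
probability that at least two of the three pairs among three independent copies are concordant.
Then `τ = 2 * p - 1`, and symmetrising `E[F(X) G(Y)]` over the orderings of three points gives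
`ρ = 2 * t - 1`. The lower bound on `ρ` says that `t ≥ cubeMin n p` for `p` between `1 / n` and
`1 / (n - 1)`; the upper bound follows by replacing `Y` with `-Y`.

Only the concordance graph matters. After rounding `(X, Y)` to cells of a grid, `p` and `t` become
polynomials in the masses of the cells, and the bound holds for every finite graph with loops whose
vertices carry masses of total `1`. Consider masses minimising `t - cubeMin n p`, and suppose that
the minimum is negative. The first and second variation under moving mass between two vertices show
that adjacent vertices have the same neighbours, so that the support is a disjoint union of
cliques, and that all cliques except perhaps one smaller one have the same size. Then `p` determines
the sizes of the cliques, and `t`, the sum of their cubes, is equal to `cubeMin n p`: a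
contradiction.

Equality holds when the plane carries blocks of these sizes, such that two points are concordant if
and only if they lie in the same block.
-/

/-- The size `R` of the large parts of the extremal partition: among all partitions of `1` with
`∑ rᵢ ^ 2 = p`, where `p ∈ [1 / n, 1 / (n - 1)]`, the sum `∑ rᵢ ^ 3` is smallest for `n - 1` parts
of size `R` and one part of size at most `R`. -/
noncomputable def largePart (n p : ℝ) : ℝ := 1 / n + √((p - 1 / n) / (n * (n - 1)))

/-- The size of the small part of the extremal partition. -/
noncomputable def smallPart (n p : ℝ) : ℝ := 1 - (n - 1) * largePart n p

/-- The sum of the cubes of the parts of the extremal partition. -/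
noncomputable def cubeMin (n p : ℝ) : ℝ := (n - 1) * largePart n p ^ 3 + smallPart n p ^ 3

section Parts

variable {n p : ℝ}

lemma one_div_le_largePart (n p : ℝ) : 1 / n ≤ largePart n p :=
  le_add_of_nonneg_right (Real.sqrt_nonneg _)

lemma one_div_lt_largePart (hn : 1 < n) (hp : 1 / n < p) : 1 / n < largePart n p :=
  lt_add_of_pos_right _ <| Real.sqrt_pos.2 <|
    div_pos (sub_pos.2 hp) (mul_pos (by linarith) (by linarith))

lemma mul_sq_largePart_sub (hn : 1 < n) (hp : 1 / n ≤ p) :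
    n * (n - 1) * (largePart n p - 1 / n) ^ 2 = p - 1 / n := by
  have hn' : 0 < n * (n - 1) := mul_pos (by linarith) (by linarith)
  rw [largePart, add_sub_cancel_left, Real.sq_sqrt (div_nonneg (sub_nonneg.2 hp) hn'.le),
    mul_div_cancel₀ _ hn'.ne']

lemma sum_sq_eq_add_mul_sq (hn : n ≠ 0) (r : ℝ) :
    (n - 1) * r ^ 2 + (1 - (n - 1) * r) ^ 2 = 1 / n + n * (n - 1) * (r - 1 / n) ^ 2 := by
  field_simp
  ring

lemma sum_sq_parts (hn : 1 < n) (hp : 1 / n ≤ p) :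
    (n - 1) * largePart n p ^ 2 + smallPart n p ^ 2 = p := by
  rw [smallPart, sum_sq_eq_add_mul_sq (by positivity), mul_sq_largePart_sub hn hp]
  ring

lemma eq_largePart (hn : 1 < n) {r : ℝ} (hr : 1 / n ≤ r)
    (hp : (n - 1) * r ^ 2 + (1 - (n - 1) * r) ^ 2 = p) : r = largePart n p := by
  have hn' : n * (n - 1) ≠ 0 := (mul_pos (by linarith) (by linarith)).ne'
  rw [largePart, ← hp, sum_sq_eq_add_mul_sq (by positivity), add_sub_cancel_left,
    mul_div_cancel_left₀ _ hn', Real.sqrt_sq (sub_nonneg.2 hr)]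
  ring

lemma largePart_sub_smallPart (hn : n ≠ 0) :
    largePart n p - smallPart n p = n * (largePart n p - 1 / n) := by
  rw [smallPart]
  field_simp
  ring

lemma smallPart_lt_largePart (hn : 1 < n) (hp : 1 / n < p) : smallPart n p < largePart n p := by
  rw [← sub_pos, largePart_sub_smallPart (by positivity)]
  exact mul_pos (by linarith) (sub_pos.2 (one_div_lt_largePart hn hp))

lemma largePart_one_div_sub_one (hn : 1 < n) : largePart n (1 / (n - 1)) = 1 / (n - 1) := by
  have hn' : 0 < n - 1 := sub_pos.2 hn
  refine (eq_largePart hn (one_div_le_one_div_of_le hn' (by linarith)) ?_).symm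
  field_simp
  ring

lemma smallPart_nonneg (hn : 1 < n) (hp : p ≤ 1 / (n - 1)) : 0 ≤ smallPart n p := by
  have hn' : 0 < n - 1 := sub_pos.2 hn
  have hR : largePart n p ≤ 1 / (n - 1) := by
    rw [← largePart_one_div_sub_one hn]
    unfold largePart
    gcongr
  have := mul_le_mul_of_nonneg_left hR hn'.le
  rw [mul_one_div_cancel hn'.ne'] at this
  exact sub_nonneg.2 this

lemma cubeMin_eq (hn : 1 < n) (hp : 1 / n ≤ p) :
    cubeMin n p = (largePart n p + smallPart n p) * p - largePart n p * smallPart n p := by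
  calc cubeMin n p = (largePart n p + smallPart n p) *
        ((n - 1) * largePart n p ^ 2 + smallPart n p ^ 2) - largePart n p * smallPart n p := by
        rw [cubeMin, smallPart]; ring
    _ = _ := by rw [sum_sq_parts hn hp]

lemma cubeMin_one_div (hn : n ≠ 0) : cubeMin n (1 / n) = (1 / n) ^ 2 := by
  simp only [cubeMin, smallPart, largePart, sub_self, zero_div, Real.sqrt_zero]
  field_simp
  ring

lemma cubeMin_one_div_sub_one (hn : 1 < n) : cubeMin n (1 / (n - 1)) = (1 / (n - 1)) ^ 2 := by
  have hn' : n - 1 ≠ 0 := (sub_pos.2 hn).ne'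
  rw [cubeMin, smallPart, largePart_one_div_sub_one hn]
  field_simp
  ring

lemma continuous_cubeMin (n : ℝ) : Continuous (cubeMin n) := by
  unfold cubeMin smallPart largePart
  fun_prop

lemma cubeMin_eq_sub_cube (hn : 1 < n) (hp : 1 / n ≤ p) :
    cubeMin n p = 1 / n ^ 2 + 3 / n * (p - 1 / n) -
      n * (n - 1) * (n - 2) * (largePart n p - 1 / n) ^ 3 := by
  rw [← mul_sq_largePart_sub hn hp, cubeMin, smallPart]
  field_simp
  ring

/-- The coefficient `3 / 2 * (R + S)` is the derivative of `cubeMin n` at `p`. -/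
lemma cubeMin_tangent (hn : 2 ≤ n) (hp : 1 / n < p) {q : ℝ} (hq : 1 / n ≤ q) :
    cubeMin n p + 3 / 2 * (largePart n p + smallPart n p) * (q - p) -
      (q - p) ^ 2 / (2 * (largePart n p - smallPart n p)) ≤ cubeMin n q := by
  have hn' : 1 < n := by linarith
  set z := largePart n p - 1 / n with hz
  set w := largePart n q - 1 / n
  have hz0 : 0 < z := sub_pos.2 (one_div_lt_largePart hn' hp)
  have hpz : p = 1 / n + n * (n - 1) * z ^ 2 := by linarith [mul_sq_largePart_sub hn' hp.le]
  have hqw : q = 1 / n + n * (n - 1) * w ^ 2 := by linarith [mul_sq_largePart_sub hn' hq]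
  have hS : largePart n p + smallPart n p = 2 / n - (n - 2) * z := by
    rw [smallPart, hz]
    field_simp
    ring
  have hgap : cubeMin n q - cubeMin n p - 3 / 2 * (2 / n - (n - 2) * z) * (q - p) +
      (q - p) ^ 2 / (2 * (n * z)) =
      n * (n - 1) * ((n - 2) * ((w - z) ^ 2 * w ^ 2) + (w ^ 2 - z ^ 2) ^ 2) / (2 * z) := by
    rw [cubeMin_eq_sub_cube hn' hp.le, cubeMin_eq_sub_cube hn' hq]
    change _ - _ * w ^ 3 - (_ - _ * z ^ 3) - _ + _ = _
    clear_value z w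
    rw [hpz, hqw]
    field_simp
    ring
  have hgap_nonneg : 0 ≤
      n * (n - 1) * ((n - 2) * ((w - z) ^ 2 * w ^ 2) + (w ^ 2 - z ^ 2) ^ 2) / (2 * z) := by
    have : 0 ≤ n - 1 := by linarith
    have : 0 ≤ n - 2 := by linarith
    positivity
  rw [hS, largePart_sub_smallPart (by positivity)]
  linarith

end Parts

/-- The probability that at least two of three independent events of probabilities `u`, `v`, `w`
occur; for `0`-`1` values this is their majority. -/
def majority (u v w : ℝ) : ℝ := u * v + v * w + u * w - 2 * (u * v * w)

lemma mul_le_majority {u v w : ℝ} (hu : u ∈ Set.Icc 0 1) (hv : v ∈ Set.Icc 0 1)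
    (hw : w ∈ Set.Icc 0 1) : u * w ≤ majority u v w := by
  have huw : 0 ≤ u * (1 - w) + w * (1 - u) :=
    add_nonneg (mul_nonneg hu.1 (sub_nonneg.2 hw.2)) (mul_nonneg hw.1 (sub_nonneg.2 hu.2))
  have := mul_nonneg hv.1 huw
  unfold majority
  linarith

lemma majority_one_sub (u v w : ℝ) :
    majority (1 - u) (1 - v) (1 - w) = 1 - majority u v w := by
  unfold majority
  ring

lemma majority_mem_Icc {u v w : ℝ} (hu : u ∈ Set.Icc 0 1) (hv : v ∈ Set.Icc 0 1)
    (hw : w ∈ Set.Icc 0 1) : majority u v w ∈ Set.Icc 0 1 := by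
  have hcompl {t : ℝ} (ht : t ∈ Set.Icc 0 1) : 1 - t ∈ Set.Icc (0 : ℝ) 1 := by
    rwa [Set.mem_Icc, sub_nonneg, sub_le_self_iff, and_comm]
  have hnonneg := (mul_nonneg hu.1 hw.1).trans (mul_le_majority hu hv hw)
  have hle := (mul_nonneg (hcompl hu).1 (hcompl hw).1).trans
    (mul_le_majority (hcompl hu) (hcompl hv) (hcompl hw))
  rw [majority_one_sub] at hle
  exact ⟨hnonneg, sub_nonneg.1 hle⟩

/-- For the adjacency matrix `e` of a graph, the indicator that `i`, `j`, `k` span at least two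
edges. -/
def majorityKernel {α : Type*} (e : α → α → ℝ) (i j k : α) : ℝ :=
  majority (e i j) (e j k) (e i k)

section WeightedSums

variable {ι : Type*} [Fintype ι] {x f g : ι → ℝ}

/-- The total weight of the neighbours of `i`, in the graph with adjacency matrix `a` and vertex
weights `x`. -/
def weightedDegree (a : ι → ι → ℝ) (x : ι → ℝ) (i : ι) : ℝ := x ⬝ᵥ a i

/-- The quadratic form of the kernel `a`: the expectation of `a` at two independent points of
distribution `x`. -/
def pairSum (a : ι → ι → ℝ) (x : ι → ℝ) : ℝ := x ⬝ᵥ weightedDegree a x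

/-- The cubic form of the kernel `c`: the expectation of `c` at three independent points of
distribution `x`. -/
def tripleSum (c : ι → ι → ι → ℝ) (x : ι → ℝ) : ℝ := x ⬝ᵥ fun i => pairSum (c i) x

lemma dotProduct_congr_of_pos (hx : 0 ≤ x) (h : ∀ i, 0 < x i → f i = g i) : x ⬝ᵥ f = x ⬝ᵥ g := by
  refine Finset.sum_congr rfl fun i _ => ?_
  rcases (hx i).eq_or_lt with h0 | h0
  · simp [← h0]
  · rw [h i h0]

lemma dotProduct_le_of_pos (hx : 0 ≤ x) (h : ∀ i, 0 < x i → f i ≤ g i) : x ⬝ᵥ f ≤ x ⬝ᵥ g := by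
  refine Finset.sum_le_sum fun i _ => ?_
  rcases (hx i).eq_or_lt with h0 | h0
  · simp [← h0]
  · exact mul_le_mul_of_nonneg_left (h i h0) h0.le

lemma dotProduct_const_of_mem_stdSimplex (hx : x ∈ stdSimplex ℝ ι) (r : ℝ) :
    (x ⬝ᵥ fun _ => r) = r := by
  rw [dotProduct, ← Finset.sum_mul, hx.2, one_mul]

lemma continuous_pairSum (a : ι → ι → ℝ) : Continuous (pairSum a) := by
  unfold pairSum weightedDegree dotProduct
  fun_prop

lemma continuous_tripleSum (c : ι → ι → ι → ℝ) : Continuous (tripleSum c) := by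
  unfold tripleSum pairSum weightedDegree dotProduct
  fun_prop

lemma pairSum_mul_mul (f x : ι → ℝ) : pairSum (fun i j => f i * f j) x = (x ⬝ᵥ f) ^ 2 := by
  simp only [pairSum, weightedDegree, dotProduct, sq, Finset.sum_mul, Finset.mul_sum]
  exact Finset.sum_congr rfl fun i _ => Finset.sum_congr rfl fun j _ => by ring

lemma pairSum_le_of_pos (hx : 0 ≤ x) {a b : ι → ι → ℝ}
    (h : ∀ i j, 0 < x i → 0 < x j → a i j ≤ b i j) : pairSum a x ≤ pairSum b x :=
  dotProduct_le_of_pos hx fun i hi => dotProduct_le_of_pos hx fun j hj => h i j hi hj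

lemma pairSum_congr_of_pos (hx : 0 ≤ x) {a b : ι → ι → ℝ}
    (h : ∀ i j, 0 < x i → 0 < x j → a i j = b i j) : pairSum a x = pairSum b x :=
  dotProduct_congr_of_pos hx fun i hi => dotProduct_congr_of_pos hx fun j hj => h i j hi hj

end WeightedSums

section ShiftMass

variable {ι : Type*} [DecidableEq ι]

/-- The weights `x` after moving mass `ε` from `j` to `i`. -/
def shiftMass (x : ι → ℝ) (i j : ι) (ε : ℝ) : ι → ℝ :=
  x + ε • (Pi.single i 1 - Pi.single j 1)

lemma continuous_shiftMass (x : ι → ℝ) (i j : ι) : Continuous (shiftMass x i j) := by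
  unfold shiftMass
  fun_prop

lemma shiftMass_zero (x : ι → ℝ) (i j : ι) : shiftMass x i j 0 = x := by
  simp [shiftMass]

variable [Fintype ι]

lemma shiftMass_dotProduct (x f : ι → ℝ) (i j : ι) (ε : ℝ) :
    shiftMass x i j ε ⬝ᵥ f = x ⬝ᵥ f + ε * (f i - f j) := by
  simp [shiftMass, add_dotProduct, sub_dotProduct]

lemma shiftMass_mem_stdSimplex {x : ι → ℝ} (hx : x ∈ stdSimplex ℝ ι) {i j : ι} (hij : i ≠ j)
    {ε : ℝ} (hi : 0 ≤ x i + ε) (hj : 0 ≤ x j - ε) : shiftMass x i j ε ∈ stdSimplex ℝ ι := by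
  refine ⟨fun k => ?_, ?_⟩
  · rcases eq_or_ne k i with rfl | hki
    · simpa [shiftMass, hij] using hi
    rcases eq_or_ne k j with rfl | hkj
    · simpa [shiftMass, hki, sub_eq_add_neg] using hj
    · simpa [shiftMass, hki, hkj] using hx.1 k
  · simpa [dotProduct, hx.2] using shiftMass_dotProduct x (fun _ => 1) i j ε

lemma pairSum_shiftMass {a : ι → ι → ℝ} (ha : ∀ k l, a k l = a l k) (x : ι → ℝ) (i j : ι) (ε : ℝ) :
    pairSum a (shiftMass x i j ε) =
      pairSum a x + 2 * ε * (weightedDegree a x i - weightedDegree a x j) +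
        ε ^ 2 * (a i i - 2 * a i j + a j j) := by
  have hdeg : weightedDegree a (shiftMass x i j ε) =
      weightedDegree a x + ε • (a i - a j) := by
    ext k
    simp [weightedDegree, shiftMass_dotProduct, ha k]
  rw [pairSum, shiftMass_dotProduct, hdeg, dotProduct_add, dotProduct_smul, dotProduct_sub]
  simp only [Pi.add_apply, Pi.smul_apply, Pi.sub_apply, smul_eq_mul, ha j i]
  change pairSum a x + ε * (weightedDegree a x i - weightedDegree a x j) + _ = _
  ring

lemma tripleSum_shiftMass {c : ι → ι → ι → ℝ} (hc : ∀ k l m, c k l m = c l k m)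
    (hc' : ∀ k l m, c k l m = c k m l) (x : ι → ℝ) (i j : ι) (ε : ℝ) :
    tripleSum c (shiftMass x i j ε) =
      tripleSum c x + 3 * ε * (pairSum (c i) x - pairSum (c j) x) +
        3 * ε ^ 2 * (x ⬝ᵥ c i i - 2 * x ⬝ᵥ c i j + x ⬝ᵥ c j j) +
        ε ^ 3 * (c i i i - 3 * c i i j + 3 * c i j j - c j j j) := by
  have hdeg (l : ι) : (fun k => weightedDegree (c k) x l) = weightedDegree (c l) x := by
    ext k
    simp only [weightedDegree, funext (hc k l)]
  have hval (l m : ι) : (fun k => c k l m) = c l m := by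
    ext k
    rw [hc, hc']
  have hpair : (fun k => pairSum (c k) (shiftMass x i j ε)) =
      (fun k => pairSum (c k) x) +
        (2 * ε) • (weightedDegree (c i) x - weightedDegree (c j) x) +
        ε ^ 2 • (c i i - (2 : ℝ) • c i j + c j j) := by
    rw [← hdeg i, ← hdeg j, ← hval i i, ← hval i j, ← hval j j]
    ext k
    simp only [pairSum_shiftMass (hc' k), Pi.add_apply, Pi.sub_apply, Pi.smul_apply, smul_eq_mul]
  have hji : c j i = c i j := funext (hc j i)
  rw [tripleSum, shiftMass_dotProduct, pairSum_shiftMass (hc' i), pairSum_shiftMass (hc' j), hpair]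
  simp only [dotProduct_add, dotProduct_sub, dotProduct_smul, smul_eq_mul]
  simp only [tripleSum, pairSum, weightedDegree, hji, hc' i j i, hc j i j]
  ring

end ShiftMass

/-- `a` is the adjacency matrix of a graph with a loop at every vertex. -/
structure IsReflGraph {ι : Type*} (a : ι → ι → ℝ) : Prop where
  symm : ∀ i j, a i j = a j i
  refl : ∀ i, a i i = 1
  zero_or_one : ∀ i j, a i j = 0 ∨ a i j = 1

namespace IsReflGraph

variable {ι : Type*} {a : ι → ι → ℝ}

lemma mem_Icc (ha : IsReflGraph a) (i j : ι) : a i j ∈ Set.Icc 0 1 := by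
  rcases ha.zero_or_one i j with h | h <;> simp [h]

lemma sq_eq (ha : IsReflGraph a) (i j : ι) : a i j ^ 2 = a i j := by
  rcases ha.zero_or_one i j with h | h <;> norm_num [h]

lemma majorityKernel_swap_left (ha : IsReflGraph a) (i j k : ι) :
    majorityKernel a i j k = majorityKernel a j i k := by
  rw [majorityKernel, majorityKernel, ha.symm j i]
  unfold majority
  ring

lemma majorityKernel_swap_right (ha : IsReflGraph a) (i j k : ι) :
    majorityKernel a i j k = majorityKernel a i k j := by
  rw [majorityKernel, majorityKernel, ha.symm k j]
  unfold majority
  ring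

lemma majorityKernel_self_left (ha : IsReflGraph a) (i k : ι) : majorityKernel a i i k = a i k := by
  rcases ha.zero_or_one i k with h | h <;> norm_num [majorityKernel, majority, ha.refl, h]

lemma mul_le_majorityKernel (ha : IsReflGraph a) (i j k : ι) :
    a i j * a i k ≤ majorityKernel a i j k :=
  mul_le_majority (ha.mem_Icc i j) (ha.mem_Icc j k) (ha.mem_Icc i k)

lemma majorityKernel_second_difference (ha : IsReflGraph a) (i j k : ι) :
    majorityKernel a i i k - 2 * majorityKernel a i j k + majorityKernel a j j k =
      (1 - 2 * a i j) * (a i k - a j k) ^ 2 := by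
  rw [ha.majorityKernel_self_left, ha.majorityKernel_self_left]
  rcases ha.zero_or_one i j with hij | hij <;> rcases ha.zero_or_one i k with hik | hik <;>
    rcases ha.zero_or_one j k with hjk | hjk <;>
    norm_num [majorityKernel, majority, hij, hik, hjk]

variable [Fintype ι] {x : ι → ℝ}

lemma sq_weightedDegree_le (ha : IsReflGraph a) (hx : 0 ≤ x) (i : ι) :
    weightedDegree a x i ^ 2 ≤ pairSum (majorityKernel a i) x := by
  rw [weightedDegree, ← pairSum_mul_mul]
  exact pairSum_le_of_pos hx fun j k _ _ => ha.mul_le_majorityKernel i j k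

lemma sq_pairSum_le_tripleSum (ha : IsReflGraph a) (hx : x ∈ stdSimplex ℝ ι) :
    pairSum a x ^ 2 ≤ tripleSum (majorityKernel a) x := by
  have hle : (x ⬝ᵥ fun i => 2 * pairSum a x * weightedDegree a x i - pairSum a x ^ 2) ≤
      tripleSum (majorityKernel a) x := dotProduct_le_of_pos hx.1 fun i _ => by
    linarith [ha.sq_weightedDegree_le hx.1 i, sq_nonneg (weightedDegree a x i - pairSum a x)]
  have heq : (x ⬝ᵥ fun i => 2 * pairSum a x * weightedDegree a x i - pairSum a x ^ 2) =
      2 * pairSum a x * pairSum a x - pairSum a x ^ 2 := by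
    change x ⬝ᵥ ((2 * pairSum a x) • weightedDegree a x - fun _ => pairSum a x ^ 2) = _
    rw [dotProduct_sub, dotProduct_smul, dotProduct_const_of_mem_stdSimplex hx, smul_eq_mul,
      ← pairSum]
  linarith

end IsReflGraph

/-- The total weight of the vertices at which the neighbourhoods of `i` and `j` differ. -/
def neighborhoodDist {ι : Type*} [Fintype ι] (a : ι → ι → ℝ) (x : ι → ℝ) (i j : ι) : ℝ :=
  x ⬝ᵥ fun k => (a i k - a j k) ^ 2

section Variation

variable {ι : Type*} [Fintype ι] {a : ι → ι → ℝ} {x : ι → ℝ}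

lemma pairSum_shiftMass_of_isReflGraph [DecidableEq ι] (ha : IsReflGraph a) (x : ι → ℝ) (i j : ι)
    (ε : ℝ) : pairSum a (shiftMass x i j ε) = pairSum a x +
      2 * ε * (weightedDegree a x i - weightedDegree a x j) + 2 * ε ^ 2 * (1 - a i j) := by
  rw [pairSum_shiftMass ha.symm, ha.refl, ha.refl]
  ring

lemma tripleSum_shiftMass_of_isReflGraph [DecidableEq ι] (ha : IsReflGraph a) (x : ι → ℝ)
    (i j : ι) (ε : ℝ) : tripleSum (majorityKernel a) (shiftMass x i j ε) =
      tripleSum (majorityKernel a) x +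
        3 * ε * (pairSum (majorityKernel a i) x - pairSum (majorityKernel a j) x) +
        3 * ε ^ 2 * ((1 - 2 * a i j) * neighborhoodDist a x i j) := by
  have hquad : x ⬝ᵥ majorityKernel a i i - 2 * x ⬝ᵥ majorityKernel a i j +
      x ⬝ᵥ majorityKernel a j j = (1 - 2 * a i j) * neighborhoodDist a x i j := by
    simp only [neighborhoodDist, dotProduct, Finset.mul_sum, ← Finset.sum_sub_distrib,
      ← Finset.sum_add_distrib]
    refine Finset.sum_congr rfl fun k _ => ?_
    linear_combination x k * ha.majorityKernel_second_difference i j k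
  have hcubic : majorityKernel a i i i - 3 * majorityKernel a i i j +
      3 * majorityKernel a i j j - majorityKernel a j j j = 0 := by
    rw [ha.majorityKernel_swap_left i j j, ha.majorityKernel_swap_right j i j]
    simp only [ha.majorityKernel_self_left, ha.refl, ha.symm j i]
    ring
  rw [tripleSum_shiftMass ha.majorityKernel_swap_left ha.majorityKernel_swap_right, hquad, hcubic]
  ring

lemma eq_zero_and_nonneg_of_eventually_nonneg {L : ℝ} {g : ℝ → ℝ} (hg : ContinuousAt g 0)
    (h : ∀ᶠ ε in nhds 0, 0 ≤ L * ε + g ε * ε ^ 2) : L = 0 ∧ 0 ≤ g 0 := by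
  have hslope : Filter.Tendsto (fun ε => L + g ε * ε) (nhds 0) (nhds L) := by
    have : ContinuousAt (fun ε => L + g ε * ε) 0 :=
      continuousAt_const.add (hg.mul continuousAt_id)
    simpa [ContinuousAt] using this
  have hfactor (ε : ℝ) : L * ε + g ε * ε ^ 2 = ε * (L + g ε * ε) := by ring
  have hL_nonneg : 0 ≤ L := by
    refine ge_of_tendsto (hslope.mono_left (nhdsWithin_le_nhds (s := Set.Ioi 0))) ?_
    filter_upwards [nhdsWithin_le_nhds h, self_mem_nhdsWithin] with ε hε hpos
    rw [hfactor] at hε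
    exact nonneg_of_mul_nonneg_right hε hpos
  have hL_nonpos : L ≤ 0 := by
    refine le_of_tendsto (hslope.mono_left (nhdsWithin_le_nhds (s := Set.Iio 0))) ?_
    filter_upwards [nhdsWithin_le_nhds h, self_mem_nhdsWithin] with ε hε hneg
    rw [hfactor] at hε
    exact nonpos_of_mul_nonneg_right hε hneg
  have hL : L = 0 := le_antisymm hL_nonpos hL_nonneg
  refine ⟨hL, ge_of_tendsto (hg.mono_left (nhdsWithin_le_nhds (s := Set.Ioi 0))) ?_⟩
  filter_upwards [nhdsWithin_le_nhds h, self_mem_nhdsWithin] with ε hε hpos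
  rw [hL, zero_mul, zero_add] at hε
  exact nonneg_of_mul_nonneg_left hε (pow_pos hpos 2)

lemma eventually_shiftMass_of_eventually [DecidableEq ι] (hx : x ∈ stdSimplex ℝ ι) {i j : ι}
    (hij : i ≠ j) (hi : 0 < x i) (hj : 0 < x j) {p : (ι → ℝ) → Prop}
    (hp : ∀ᶠ y in nhdsWithin x (stdSimplex ℝ ι), p y) :
    ∀ᶠ ε in nhds (0 : ℝ), p (shiftMass x i j ε) := by
  have hlim : Filter.Tendsto (shiftMass x i j) (nhds 0) (nhds x) := by
    simpa [shiftMass_zero] using (continuous_shiftMass x i j).tendsto 0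
  filter_upwards [hlim.eventually (eventually_nhdsWithin_iff.1 hp), Ioi_mem_nhds (neg_lt_zero.2 hi),
    Iio_mem_nhds hj] with ε hε hεi hεj
  exact hε (shiftMass_mem_stdSimplex hx hij (neg_le_iff_add_nonneg'.1 (le_of_lt hεi))
    (sub_nonneg.2 (le_of_lt hεj)))

/-- The first and second order conditions at a local minimum of
`tripleSum - 3 / 2 * σ * pairSum + K * (pairSum - p) ^ 2`, where `p` is the value of `pairSum` at
the minimum, with respect to moving mass between two vertices. -/
structure IsStationaryWeighting (a : ι → ι → ℝ) (x : ι → ℝ) (σ K : ℝ) : Prop where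
  first_order : ∀ i j, 0 < x i → 0 < x j →
    pairSum (majorityKernel a i) x - pairSum (majorityKernel a j) x =
      σ * (weightedDegree a x i - weightedDegree a x j)
  second_order : ∀ i j, 0 < x i → 0 < x j →
    0 ≤ 3 * ((1 - 2 * a i j) * neighborhoodDist a x i j) - 3 * σ * (1 - a i j) +
      4 * K * (weightedDegree a x i - weightedDegree a x j) ^ 2

lemma isStationaryWeighting_of_isLocalMinOn (ha : IsReflGraph a) (hx : x ∈ stdSimplex ℝ ι)
    {σ K : ℝ} (hmin : IsLocalMinOn (fun y => tripleSum (majorityKernel a) y -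
      3 / 2 * σ * pairSum a y + K * (pairSum a y - pairSum a x) ^ 2) (stdSimplex ℝ ι) x) :
    IsStationaryWeighting a x σ K := by
  classical
  have hvar {i j : ι} (hij : i ≠ j) (hi : 0 < x i) (hj : 0 < x j) :
      3 * (pairSum (majorityKernel a i) x - pairSum (majorityKernel a j) x -
        σ * (weightedDegree a x i - weightedDegree a x j)) = 0 ∧
      0 ≤ 3 * ((1 - 2 * a i j) * neighborhoodDist a x i j) - 3 * σ * (1 - a i j) +
        4 * K * (weightedDegree a x i - weightedDegree a x j + 0 * (1 - a i j)) ^ 2 := by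
    refine eq_zero_and_nonneg_of_eventually_nonneg
      (g := fun ε => 3 * ((1 - 2 * a i j) * neighborhoodDist a x i j) - 3 * σ * (1 - a i j) +
        4 * K * (weightedDegree a x i - weightedDegree a x j + ε * (1 - a i j)) ^ 2)
      (by fun_prop) ?_
    filter_upwards [eventually_shiftMass_of_eventually hx hij hi hj hmin] with ε hε
    rw [tripleSum_shiftMass_of_isReflGraph ha, pairSum_shiftMass_of_isReflGraph ha] at hε
    linarith
  refine ⟨fun i j hi hj => ?_, fun i j hi hj => ?_⟩ <;> rcases eq_or_ne i j with rfl | hij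
  · ring
  · linarith [(hvar hij hi hj).1]
  · simp [neighborhoodDist, ha.refl, dotProduct]
  · simpa using (hvar hij hi hj).2

end Variation

/-- The graph with adjacency matrix `a` induces a disjoint union of cliques on the support
of `x`. -/
def IsCliqueUnion {ι : Type*} (a : ι → ι → ℝ) (x : ι → ℝ) : Prop :=
  ∀ i j, 0 < x i → 0 < x j → a i j = 1 → ∀ k, 0 < x k → a i k = a j k

section Cliques

variable {ι : Type*} [Fintype ι] {a : ι → ι → ℝ} {x : ι → ℝ}

lemma weightedDegree_pos (ha : IsReflGraph a) (hx : 0 ≤ x) {i : ι} (hi : 0 < x i) :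
    0 < weightedDegree a x i :=
  Finset.sum_pos' (fun j _ => mul_nonneg (hx j) (ha.mem_Icc i j).1)
    ⟨i, Finset.mem_univ i, by rwa [ha.refl, mul_one]⟩

lemma abs_weightedDegree_sub_le (ha : IsReflGraph a) (hx : 0 ≤ x) (i j : ι) :
    |weightedDegree a x i - weightedDegree a x j| ≤ neighborhoodDist a x i j := by
  have habs (k : ι) : |a i k - a j k| = (a i k - a j k) ^ 2 := by
    rcases ha.zero_or_one i k with h | h <;> rcases ha.zero_or_one j k with h' | h' <;>
      norm_num [h, h']
  simp only [weightedDegree, ← dotProduct_sub, neighborhoodDist, ← habs]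
  refine (Finset.abs_sum_le_sum_abs _ _).trans_eq (Finset.sum_congr rfl fun k _ => ?_)
  rw [abs_mul, abs_of_nonneg (hx k), Pi.sub_apply]

lemma eq_of_neighborhoodDist_nonpos (hx : 0 ≤ x) {i j : ι} (h : neighborhoodDist a x i j ≤ 0)
    {k : ι} (hk : 0 < x k) : a i k = a j k := by
  have hterm (l : ι) : 0 ≤ x l * (a i l - a j l) ^ 2 := mul_nonneg (hx l) (sq_nonneg _)
  have hzero := (Finset.sum_eq_zero_iff_of_nonneg fun l _ => hterm l).1
    (h.antisymm (Finset.sum_nonneg fun l _ => hterm l)) k (Finset.mem_univ k)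
  exact sub_eq_zero.1 (pow_eq_zero_iff two_ne_zero |>.1 ((mul_eq_zero.1 hzero).resolve_left hk.ne'))

lemma sum_div_sum_fiber {κ : Type*} [DecidableEq κ] (f : ι → κ) (x : ι → ℝ) :
    ∑ i, x i / ∑ j with f j = f i, x j =
      ((Finset.univ.image f).filter fun b => ∑ j with f j = b, x j ≠ 0).card := by
  rw [← Finset.sum_fiberwise_of_maps_to fun i _ => Finset.mem_image_of_mem f (Finset.mem_univ i),
    Finset.card_filter, Nat.cast_sum]
  refine Finset.sum_congr rfl fun b _ => ?_
  have hfiber : ∑ i with f i = b, x i / ∑ j with f j = f i, x j =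
      (∑ i with f i = b, x i) / ∑ j with f j = b, x j := by
    rw [Finset.sum_div]
    refine Finset.sum_congr rfl fun i hi => ?_
    rw [(Finset.mem_filter.1 hi).2]
  rw [hfiber]
  split_ifs with hb
  · rw [div_self hb, Nat.cast_one]
  · rw [not_not.1 hb, div_zero, Nat.cast_zero]

namespace IsCliqueUnion

lemma weightedDegree_eq_of_adj (hcl : IsCliqueUnion a x) (hx : 0 ≤ x) {i j : ι} (hi : 0 < x i)
    (hj : 0 < x j) (hij : a i j = 1) : weightedDegree a x i = weightedDegree a x j :=
  dotProduct_congr_of_pos hx (hcl i j hi hj hij)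

/-- The sum counts the cliques, as the terms of each clique add up to `1`. -/
lemma exists_nat_sum_inv_weightedDegree (hcl : IsCliqueUnion a x) (ha : IsReflGraph a)
    (hx : 0 ≤ x) :
    ∃ m : ℕ, (x ⬝ᵥ fun i => (weightedDegree a x i)⁻¹) = m := by
  classical
  let f (i : ι) (k : {k // 0 < x k}) : ℝ := a i k
  have hf {i j : ι} (hi : 0 < x i) (hj : 0 < x j) : f j = f i ↔ a i j = 1 := by
    refine ⟨fun h => ?_, fun h => funext fun k => (hcl i j hi hj h k k.2).symm⟩
    simpa [f, ha.refl] using (congrFun h ⟨j, hj⟩).symm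
  have hdeg {i : ι} (hi : 0 < x i) : ∑ j with f j = f i, x j = weightedDegree a x i := by
    rw [Finset.sum_filter]
    have := dotProduct_congr_of_pos (f := fun j => if f j = f i then (1 : ℝ) else 0) (g := a i) hx
      fun j hj => by
        rcases ha.zero_or_one i j with h | h <;> simp [hf hi hj, h]
    simpa [dotProduct, weightedDegree] using this
  refine ⟨_, Eq.trans ?_ (sum_div_sum_fiber f x)⟩
  exact dotProduct_congr_of_pos hx fun i hi => by rw [hdeg hi]

lemma pairSum_majorityKernel (hcl : IsCliqueUnion a x) (ha : IsReflGraph a) (hx : 0 ≤ x) {i : ι}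
    (hi : 0 < x i) :
    pairSum (majorityKernel a i) x = weightedDegree a x i ^ 2 := by
  rw [weightedDegree, ← pairSum_mul_mul]
  refine pairSum_congr_of_pos hx fun j k hj hk => ?_
  have hjk : (a i j - a i k) * a j k = 0 := by
    rcases ha.zero_or_one j k with h | h
    · rw [h, mul_zero]
    · rw [ha.symm i j, ha.symm i k, hcl j k hj hk h i hi, sub_self, zero_mul]
  unfold majorityKernel majority
  linear_combination (a i j - a i k) * hjk - a j k * ha.sq_eq i j - a j k * ha.sq_eq i k

lemma neighborhoodDist_of_not_adj (hcl : IsCliqueUnion a x) (ha : IsReflGraph a) (hx : 0 ≤ x)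
    {i j : ι} (hi : 0 < x i) (hj : 0 < x j) (hij : a i j = 0) :
    neighborhoodDist a x i j = weightedDegree a x i + weightedDegree a x j := by
  rw [weightedDegree, weightedDegree, ← dotProduct_add]
  refine dotProduct_congr_of_pos hx fun k hk => ?_
  have hdisj : a i k * a j k = 0 := by
    rcases ha.zero_or_one i k with hik | hik
    · rw [hik, zero_mul]
    · rw [ha.symm j k, ← hcl i k hi hk hik j hj, hij, mul_zero]
  change (a i k - a j k) ^ 2 = a i k + a j k
  linear_combination ha.sq_eq i k + ha.sq_eq j k - 2 * hdisj

end IsCliqueUnion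

end Cliques

section Extremal

variable {ι : Type*} [Fintype ι] {a : ι → ι → ℝ} {x : ι → ℝ}

namespace IsStationaryWeighting

variable {σ K : ℝ}

lemma sq_weightedDegree_sub_le (hst : IsStationaryWeighting a x σ K) (ha : IsReflGraph a)
    (hx : x ∈ stdSimplex ℝ ι) {i : ι} (hi : 0 < x i) :
    weightedDegree a x i ^ 2 - σ * weightedDegree a x i ≤
      tripleSum (majorityKernel a) x - σ * pairSum a x := by
  have hconst : x ⬝ᵥ ((fun j => pairSum (majorityKernel a j) x) - σ • weightedDegree a x) =
      pairSum (majorityKernel a i) x - σ * weightedDegree a x i := by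
    rw [← dotProduct_const_of_mem_stdSimplex hx (pairSum _ x - _)]
    refine dotProduct_congr_of_pos hx.1 fun j hj => ?_
    simp only [Pi.sub_apply, Pi.smul_apply, smul_eq_mul]
    linarith [hst.first_order i j hi hj]
  rw [dotProduct_sub, dotProduct_smul, smul_eq_mul, ← tripleSum, ← pairSum] at hconst
  linarith [ha.sq_weightedDegree_le hx.1 i]

lemma isCliqueUnion (hst : IsStationaryWeighting a x σ K) (ha : IsReflGraph a) (hx : 0 ≤ x)
    (hK : ∀ i j, 0 < x i → 0 < x j →
      K * (weightedDegree a x i - weightedDegree a x j) ^ 2 ≤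
        |weightedDegree a x i - weightedDegree a x j| / 2) : IsCliqueUnion a x := by
  intro i j hi hj hij k hk
  have hsecond := hst.second_order i j hi hj
  rw [hij] at hsecond
  refine eq_of_neighborhoodDist_nonpos hx ?_ hk
  linarith [hK i j hi hj, abs_weightedDegree_sub_le ha hx i j]

/-- Both conditions together exclude two cliques of the same size less than `σ / 2`. -/
lemma weightedDegree_of_not_adj (hst : IsStationaryWeighting a x σ K) (ha : IsReflGraph a)
    (hcl : IsCliqueUnion a x) (hx : 0 ≤ x) {i j : ι} (hi : 0 < x i) (hj : 0 < x j)
    (hij : a i j = 0) (hle : weightedDegree a x i ≤ weightedDegree a x j) :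
    weightedDegree a x j = max (weightedDegree a x i) (σ - weightedDegree a x i) := by
  have hfirst := hst.first_order i j hi hj
  rw [hcl.pairSum_majorityKernel ha hx hi, hcl.pairSum_majorityKernel ha hx hj] at hfirst
  have hfactor : (weightedDegree a x i - weightedDegree a x j) *
      (weightedDegree a x i + weightedDegree a x j - σ) = 0 := by linear_combination hfirst
  rcases mul_eq_zero.1 hfactor with heq | hsum
  · have hsecond := hst.second_order i j hi hj
    rw [hij, hcl.neighborhoodDist_of_not_adj ha hx hi hj hij, heq] at hsecond
    rw [max_eq_left] <;> linarith
  · rw [max_eq_right] <;> linarith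

end IsStationaryWeighting

lemma IsCliqueUnion.dotProduct_comp_weightedDegree (hcl : IsCliqueUnion a x) (ha : IsReflGraph a)
    (hx : x ∈ stdSimplex ℝ ι) {i : ι} (hi : 0 < x i) {β : ℝ}
    (hβ : ∀ j, 0 < x j → a i j = 0 → weightedDegree a x j = β) (φ : ℝ → ℝ) :
    (x ⬝ᵥ fun j => φ (weightedDegree a x j)) = weightedDegree a x i * φ (weightedDegree a x i) +
      (1 - weightedDegree a x i) * φ β := by
  have hφ : (x ⬝ᵥ fun j => φ (weightedDegree a x j)) =
      x ⬝ᵥ ((φ (weightedDegree a x i) - φ β) • a i + fun _ => φ β) := by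
    refine dotProduct_congr_of_pos hx.1 fun j hj => ?_
    simp only [Pi.add_apply, Pi.smul_apply, smul_eq_mul]
    rcases ha.zero_or_one i j with hij | hij
    · rw [hβ j hj hij, hij]
      ring
    · rw [hcl.weightedDegree_eq_of_adj hx.1 hi hj hij, hij]
      ring
  rw [hφ, dotProduct_add, dotProduct_smul, dotProduct_const_of_mem_stdSimplex hx, smul_eq_mul,
    ← weightedDegree]
  ring

lemma IsCliqueUnion.exists_nat_of_two_sizes (hcl : IsCliqueUnion a x) (ha : IsReflGraph a)
    (hx : x ∈ stdSimplex ℝ ι) {i : ι} (hi : 0 < x i) {β : ℝ} (hβ_pos : 0 < β)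
    (hβ : ∀ j, 0 < x j → a i j = 0 → weightedDegree a x j = β) :
    ∃ m : ℕ, ((m : ℝ) - 1) * β = 1 - weightedDegree a x i ∧
      pairSum a x = weightedDegree a x i ^ 2 + (1 - weightedDegree a x i) * β := by
  have hsum := hcl.dotProduct_comp_weightedDegree ha hx hi hβ
  obtain ⟨m, hm⟩ := hcl.exists_nat_sum_inv_weightedDegree ha hx.1
  refine ⟨m, ?_, by rw [sq]; exact hsum id⟩
  rw [← hm, hsum, mul_inv_cancel₀ (weightedDegree_pos ha hx.1 hi).ne', add_sub_cancel_left,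
    inv_mul_cancel_right₀ hβ_pos.ne']

lemma eq_of_natCast_mul_bounds {n m : ℕ} {p : ℝ} (hm : 1 ≤ m * p) (hm' : (m - 1) * p < 1)
    (hn : 1 ≤ n * p) (hn' : (n - 1) * p < 1) : m = n := by
  have hp : 0 < p := pos_of_mul_pos_left (by linarith) (Nat.cast_nonneg m)
  have hlt : (m : ℝ) - 1 < n := lt_of_mul_lt_mul_right (by linarith) hp.le
  have hgt : (n : ℝ) - 1 < m := lt_of_mul_lt_mul_right (by linarith) hp.le
  have hlt' : m < n + 1 := by exact_mod_cast sub_lt_iff_lt_add.1 hlt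
  have hgt' : n < m + 1 := by exact_mod_cast sub_lt_iff_lt_add.1 hgt
  omega

lemma eq_largePart_and_eq_smallPart {n m : ℕ} {p α β : ℝ} (hn : 2 ≤ n) (hp : 1 / (n : ℝ) < p)
    (hp' : p < 1 / ((n : ℝ) - 1)) (hα : 0 < α) (hαβ : α ≤ β) (hm : ((m : ℝ) - 1) * β = 1 - α)
    (hsq : α ^ 2 + (1 - α) * β = p) : β = largePart n p ∧ α = smallPart n p := by
  have hn' : (1 : ℝ) < n := by exact_mod_cast hn
  rw [div_lt_iff₀' (by positivity)] at hp
  rw [lt_div_iff₀' (sub_pos.2 hn')] at hp'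
  have hα_eq : α = 1 - (m - 1) * β := by linarith
  have hm_pos : (1 : ℝ) ≤ m := by
    have : m ≠ 0 := by
      rintro rfl
      rw [Nat.cast_zero] at hm
      linarith
    exact_mod_cast Nat.one_le_iff_ne_zero.2 this
  have hgap : 0 ≤ (m - 1) * (β - α) := mul_nonneg (sub_nonneg.2 hm_pos) (sub_nonneg.2 hαβ)
  have hm_lower : 0 ≤ m * p - 1 := by
    have : m * p - 1 = (m - 1) * (β - α) * (β - α) := by
      rw [← hsq, hα_eq]
      ring
    rw [this]
    exact mul_nonneg hgap (sub_nonneg.2 hαβ)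
  have hm_upper : 0 < 1 - (m - 1) * p := by
    have : 1 - (m - 1) * p = α * (1 + (m - 1) * (β - α)) := by
      rw [← hsq, hα_eq]
      ring
    rw [this]
    positivity
  obtain rfl : m = n := eq_of_natCast_mul_bounds (p := p) (by linarith) (by linarith) hp.le hp'
  have hβ : β = largePart m p := by
    refine eq_largePart hn' ?_ ?_
    · rw [div_le_iff₀' (by positivity)]
      linarith
    · rw [← hα_eq, ← hsq, ← hm]
      ring
  exact ⟨hβ, by rw [smallPart, ← hβ, hα_eq]⟩

lemma exists_pos_and_forall_le (hx : x ∈ stdSimplex ℝ ι) (f : ι → ℝ) :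
    ∃ i, 0 < x i ∧ ∀ j, 0 < x j → f i ≤ f j := by
  have hne : (Finset.univ.filter fun i => 0 < x i).Nonempty := by
    obtain ⟨i, -, hi⟩ := Finset.exists_lt_of_sum_lt (s := Finset.univ) (f := 0) (g := x)
      (by simp [hx.2])
    exact ⟨i, Finset.mem_filter_univ i |>.2 hi⟩
  obtain ⟨i, hi, hmin⟩ := Finset.exists_min_image _ f hne
  simp only [Finset.mem_filter_univ] at hi hmin
  exact ⟨i, hi, hmin⟩

lemma IsStationaryWeighting.weightedDegree_mem_Ioo (ha : IsReflGraph a)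
    (hx : x ∈ stdSimplex ℝ ι) {n p : ℝ} (hn : 1 < n) (hp : pairSum a x = p) (hp_gt : 1 / n < p)
    {K : ℝ} (hst : IsStationaryWeighting a x (largePart n p + smallPart n p) K)
    (hlt : tripleSum (majorityKernel a) x < cubeMin n p) {i : ι} (hi : 0 < x i) :
    weightedDegree a x i ∈ Set.Ioo (smallPart n p) (largePart n p) := by
  have hle := hst.sq_weightedDegree_sub_le ha hx hi
  rw [hp] at hle
  rw [cubeMin_eq hn hp_gt.le] at hlt
  have hprod : (weightedDegree a x i - smallPart n p) *
      (weightedDegree a x i - largePart n p) < 0 := by linarith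
  rcases mul_neg_iff.1 hprod with h | h
  · exact ⟨sub_pos.1 h.1, sub_neg.1 h.2⟩
  · linarith [smallPart_lt_largePart hn hp_gt]

lemma IsStationaryWeighting.cubeMin_le_tripleSum (ha : IsReflGraph a) (hx : x ∈ stdSimplex ℝ ι)
    {n : ℕ} (hn : 2 ≤ n) {p : ℝ} (hp : pairSum a x = p) (hp_gt : 1 / (n : ℝ) < p)
    (hp_lt : p < 1 / ((n : ℝ) - 1))
    (hst : IsStationaryWeighting a x (largePart n p + smallPart n p)
      (1 / (2 * (largePart n p - smallPart n p)))) :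
    cubeMin n p ≤ tripleSum (majorityKernel a) x := by
  by_contra! hlt
  have hn' : (1 : ℝ) < n := by exact_mod_cast hn
  have hdeg {i : ι} (hi : 0 < x i) := hst.weightedDegree_mem_Ioo ha hx hn' hp hp_gt hlt hi
  have hcl : IsCliqueUnion a x := hst.isCliqueUnion ha hx.1 fun i j hi hj => by
    have habs : |weightedDegree a x i - weightedDegree a x j| ≤ largePart n p - smallPart n p :=
      abs_sub_le_iff.2 ⟨by linarith [(hdeg hi).2, (hdeg hj).1],
        by linarith [(hdeg hi).1, (hdeg hj).2]⟩
    rw [one_div_mul_eq_div, div_le_iff₀ (by linarith [smallPart_lt_largePart hn' hp_gt]), ← sq_abs]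
    nlinarith [abs_nonneg (weightedDegree a x i - weightedDegree a x j)]
  obtain ⟨i, hi, hmin⟩ := exists_pos_and_forall_le hx (weightedDegree a x)
  set α := weightedDegree a x i
  obtain ⟨m, hm, hsq⟩ := hcl.exists_nat_of_two_sizes ha hx hi
    (weightedDegree_pos ha hx.1 hi |>.trans_le (le_max_left _ _)) fun j hj hij =>
      hst.weightedDegree_of_not_adj ha hcl hx.1 hi hj hij (hmin j hj)
  exact (hdeg hi).1.ne' (eq_largePart_and_eq_smallPart hn hp_gt hp_lt
    (weightedDegree_pos ha hx.1 hi) (le_max_left _ _) hm (hsq.symm.trans hp)).2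

lemma continuous_tripleSum_sub_cubeMin (a : ι → ι → ℝ) (n : ℝ) :
    Continuous fun y => tripleSum (majorityKernel a) y - cubeMin n (pairSum a y) :=
  (continuous_tripleSum _).sub ((continuous_cubeMin n).comp (continuous_pairSum a))

lemma cubeMin_le_tripleSum_of_isMinOn (ha : IsReflGraph a) {n : ℕ} (hn : 2 ≤ n)
    (hx : x ∈ stdSimplex ℝ ι) (hp_gt : 1 / (n : ℝ) < pairSum a x)
    (hp_lt : pairSum a x < 1 / ((n : ℝ) - 1))
    (hmin : IsMinOn (fun y => tripleSum (majorityKernel a) y - cubeMin n (pairSum a y))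
      (stdSimplex ℝ ι ∩ pairSum a ⁻¹' Set.Icc (1 / n) (1 / (n - 1))) x) :
    cubeMin n (pairSum a x) ≤ tripleSum (majorityKernel a) x := by
  refine IsStationaryWeighting.cubeMin_le_tripleSum ha hx hn rfl hp_gt hp_lt
    (isStationaryWeighting_of_isLocalMinOn ha hx ?_)
  have hnhds : ∀ᶠ y in nhdsWithin x (stdSimplex ℝ ι),
      pairSum a y ∈ Set.Icc (1 / (n : ℝ)) (1 / (n - 1)) :=
    nhdsWithin_le_nhds ((continuous_pairSum a).continuousAt.eventually_mem
      (Icc_mem_nhds hp_gt hp_lt))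
  filter_upwards [hnhds, self_mem_nhdsWithin] with y hy hyx
  have hle := isMinOn_iff.1 hmin y ⟨hyx, hy⟩
  have htangent := cubeMin_tangent (by exact_mod_cast hn) hp_gt hy.1
  rw [sub_self (pairSum a x), zero_pow two_ne_zero, mul_zero, one_div_mul_eq_div]
  linarith

theorem cubeMin_le_tripleSum (ha : IsReflGraph a) {n : ℕ} (hn : 2 ≤ n)
    (hx : x ∈ stdSimplex ℝ ι) (hp : pairSum a x ∈ Set.Icc (1 / (n : ℝ)) (1 / (n - 1))) :
    cubeMin n (pairSum a x) ≤ tripleSum (majorityKernel a) x := by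
  have hn' : (1 : ℝ) < n := by exact_mod_cast hn
  obtain ⟨y, ⟨hy, hyp⟩, hmin⟩ := ((isCompact_stdSimplex ℝ ι).inter_right
    (isClosed_Icc.preimage (continuous_pairSum a))).exists_isMinOn ⟨x, hx, hp⟩
    (continuous_tripleSum_sub_cubeMin a n).continuousOn
  suffices h : cubeMin n (pairSum a y) ≤ tripleSum (majorityKernel a) y from
    sub_nonneg.1 ((sub_nonneg.2 h).trans (isMinOn_iff.1 hmin x ⟨hx, hp⟩))
  rcases hyp.1.eq_or_lt with heq | hgt
  · rw [← heq, cubeMin_one_div (by positivity), heq]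
    exact ha.sq_pairSum_le_tripleSum hy
  rcases hyp.2.eq_or_lt with heq | hlt
  · rw [heq, cubeMin_one_div_sub_one hn', ← heq]
    exact ha.sq_pairSum_le_tripleSum hy
  · exact cubeMin_le_tripleSum_of_isMinOn ha hn hy hgt hlt hmin

end Extremal

section Means

variable {Ω : Type*} [MeasurableSpace Ω] {P : Measure Ω}

/-- The expectation of the kernel `e` at two independent points of distribution `P`. -/
noncomputable def pairMean (P : Measure Ω) (e : Ω → Ω → ℝ) : ℝ := ∫ t, e t.1 t.2 ∂P.prod P

/-- The expectation of the kernel `c` at three independent points of distribution `P`. -/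
noncomputable def tripleMean (P : Measure Ω) (c : Ω → Ω → Ω → ℝ) : ℝ :=
  ∫ t, c t.1 t.2.1 t.2.2 ∂P.prod (P.prod P)

section Symmetrization

variable [SFinite P] {c : Ω → Ω → Ω → ℝ}

lemma measurePreserving_swap_right :
    MeasurePreserving
      ((MeasurableEquiv.refl Ω).prodCongr (MeasurableEquiv.prodComm (α := Ω) (β := Ω)))
      (P.prod (P.prod P)) (P.prod (P.prod P)) :=
  (MeasurePreserving.id P).prod Measure.measurePreserving_swap

lemma measurePreserving_swap_left :
    MeasurePreserving (MeasurableEquiv.prodAssoc.symm.trans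
      (((MeasurableEquiv.prodComm (α := Ω) (β := Ω)).prodCongr (MeasurableEquiv.refl Ω)).trans
        MeasurableEquiv.prodAssoc)) (P.prod (P.prod P)) (P.prod (P.prod P)) :=
  (measurePreserving_prodAssoc P P P).comp
    ((Measure.measurePreserving_swap.prod (MeasurePreserving.id P)).comp
      ((measurePreserving_prodAssoc P P P).symm MeasurableEquiv.prodAssoc))

lemma tripleMean_swap_right (c : Ω → Ω → Ω → ℝ) :
    tripleMean P (fun i j k => c i k j) = tripleMean P c :=
  measurePreserving_swap_right.integral_comp' fun t : Ω × Ω × Ω => c t.1 t.2.1 t.2.2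

lemma tripleMean_swap_left (c : Ω → Ω → Ω → ℝ) :
    tripleMean P (fun i j k => c j i k) = tripleMean P c :=
  measurePreserving_swap_left.integral_comp' fun t : Ω × Ω × Ω => c t.1 t.2.1 t.2.2

lemma six_mul_tripleMean
    (hc : Integrable (fun t : Ω × Ω × Ω => c t.1 t.2.1 t.2.2) (P.prod (P.prod P))) :
    6 * tripleMean P c = tripleMean P fun i j k =>
      c i j k + c i k j + (c j i k + c j k i) + (c k i j + c k j i) := by
  set c₂ : Ω → Ω → Ω → ℝ := fun i j k => c i j k + c i k j
  have hright : Integrable (fun t : Ω × Ω × Ω => c t.1 t.2.2 t.2.1) (P.prod (P.prod P)) :=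
    measurePreserving_swap_right.integrable_comp_of_integrable hc
  have hc₂ : Integrable (fun t : Ω × Ω × Ω => c₂ t.1 t.2.1 t.2.2) (P.prod (P.prod P)) :=
    hc.add hright
  have hleft₂ : Integrable (fun t : Ω × Ω × Ω => c₂ t.2.1 t.1 t.2.2) (P.prod (P.prod P)) :=
    measurePreserving_swap_left.integrable_comp_of_integrable hc₂
  have hcycle₂ : Integrable (fun t : Ω × Ω × Ω => c₂ t.2.2 t.1 t.2.1) (P.prod (P.prod P)) :=
    measurePreserving_swap_right.integrable_comp_of_integrable hleft₂
  have hmean₂ : tripleMean P c₂ = tripleMean P c + tripleMean P fun i j k => c i k j :=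
    integral_add hc hright
  have hmean₆ : (tripleMean P fun i j k => c₂ i j k + c₂ j i k + c₂ k i j) = tripleMean P c₂ +
      (tripleMean P fun i j k => c₂ j i k) + tripleMean P fun i j k => c₂ k i j :=
    (integral_add (hc₂.add hleft₂) hcycle₂).trans (congrArg (· + _) (integral_add hc₂ hleft₂))
  rw [hmean₆, tripleMean_swap_right fun i j k => c₂ j i k, tripleMean_swap_left c₂, hmean₂,
    tripleMean_swap_right c]
  ring

end Symmetrization

lemma ae_triple_of_ae_pair [IsProbabilityMeasure P] {r : Ω → Ω → Prop}
    (h : ∀ᵐ t ∂P.prod P, r t.1 t.2) :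
    ∀ᵐ t ∂P.prod (P.prod P), r t.1 t.2.1 ∧ r t.2.1 t.2.2 ∧ r t.1 t.2.2 := by
  have h₁₂ := ((MeasurePreserving.id P).prod
    (measurePreserving_fst (μ := P) (ν := P))).quasiMeasurePreserving.ae h
  have h₁₃ := ((MeasurePreserving.id P).prod
    (measurePreserving_snd (μ := P) (ν := P))).quasiMeasurePreserving.ae h
  have h₂₃ := (measurePreserving_snd (μ := P) (ν := P.prod P)).quasiMeasurePreserving.ae h
  filter_upwards [h₁₂, h₂₃, h₁₃] with t using fun h₁₂ h₂₃ h₁₃ => ⟨h₁₂, h₂₃, h₁₃⟩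

end Means

section FiniteValued

/-- The distribution of the random variable `c`, as a vector of point masses. -/
noncomputable def pointMass {Ω ι : Type*} [MeasurableSpace Ω] (P : Measure Ω) (c : Ω → ι) (i : ι) :
    ℝ :=
  P.real (c ⁻¹' {i})

lemma pointMass_prodMap_dotProduct {Ω Ω' ι κ : Type*} [MeasurableSpace Ω] [MeasurableSpace Ω']
    {P : Measure Ω} {Q : Measure Ω'} [SFinite Q] [Fintype ι] [Fintype κ] {c : Ω → ι} {d : Ω' → κ}
    (f : ι × κ → ℝ) :
    pointMass (P.prod Q) (Prod.map c d) ⬝ᵥ f =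
      pointMass P c ⬝ᵥ fun i => pointMass Q d ⬝ᵥ fun j => f (i, j) := by
  simp only [dotProduct, Fintype.sum_prod_type, Finset.mul_sum]
  refine Finset.sum_congr rfl fun i _ => Finset.sum_congr rfl fun j _ => ?_
  rw [pointMass, ← Set.singleton_prod_singleton, Set.preimage_prod_map_prod,
    measureReal_prod_prod, mul_assoc, pointMass, pointMass]

variable {Ω : Type*} [MeasurableSpace Ω] {P : Measure Ω} [IsProbabilityMeasure P] {ι : Type*}
  [Fintype ι] [MeasurableSpace ι] [MeasurableSingletonClass ι] {c : Ω → ι}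

lemma integral_comp_eq_dotProduct (hc : Measurable c) (f : ι → ℝ) :
    ∫ ω, f (c ω) ∂P = pointMass P c ⬝ᵥ f := by
  have : IsProbabilityMeasure (P.map c) := Measure.isProbabilityMeasure_map hc.aemeasurable
  rw [← integral_map hc.aemeasurable Measurable.of_discrete.aestronglyMeasurable,
    integral_fintype .of_finite]
  exact Finset.sum_congr rfl fun i _ => by
    rw [map_measureReal_apply hc (measurableSet_singleton i), smul_eq_mul, pointMass]

lemma pointMass_mem_stdSimplex (hc : Measurable c) : pointMass P c ∈ stdSimplex ℝ ι := by
  refine ⟨fun i => measureReal_nonneg, ?_⟩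
  rw [← dotProduct_one, ← integral_comp_eq_dotProduct hc]
  simp

lemma pairMean_comp (hc : Measurable c) (a : ι → ι → ℝ) :
    pairMean P (fun x y => a (c x) (c y)) = pairSum a (pointMass P c) := by
  refine (integral_comp_eq_dotProduct (hc.prodMap hc) (Function.uncurry a)).trans ?_
  exact pointMass_prodMap_dotProduct _

lemma tripleMean_comp (hc : Measurable c) (k : ι → ι → ι → ℝ) :
    tripleMean P (fun x y z => k (c x) (c y) (c z)) = tripleSum k (pointMass P c) := by
  refine (integral_comp_eq_dotProduct (hc.prodMap (hc.prodMap hc))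
    fun t => k t.1 t.2.1 t.2.2).trans ?_
  rw [pointMass_prodMap_dotProduct]
  simp only [pointMass_prodMap_dotProduct]
  rfl

end FiniteValued

section Limit

variable {Ω : Type*} [MeasurableSpace Ω] {P : Measure Ω}

lemma tendsto_integral_of_eventually_eq [IsFiniteMeasure P] {f : ℕ → Ω → ℝ} {g : Ω → ℝ}
    (hf : ∀ m, Measurable (f m)) (h01 : ∀ m ω, f m ω ∈ Set.Icc 0 1)
    (hfg : ∀ᵐ ω ∂P, ∀ᶠ m in Filter.atTop, f m ω = g ω) :
    Filter.Tendsto (fun m => ∫ ω, f m ω ∂P) Filter.atTop (nhds (∫ ω, g ω ∂P)) := by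
  refine tendsto_integral_of_dominated_convergence (fun _ => 1)
    (fun m => (hf m).aestronglyMeasurable) (integrable_const 1) (fun m => .of_forall fun ω => ?_) ?_
  · rw [Real.norm_of_nonneg (h01 m ω).1]
    exact (h01 m ω).2
  · filter_upwards [hfg] with ω hω using tendsto_nhds_of_eventually_eq hω

theorem cubeMin_le_tripleMean [IsProbabilityMeasure P] {ι : ℕ → Type*} [∀ m, Finite (ι m)]
    [∀ m, MeasurableSpace (ι m)] [∀ m, MeasurableSingletonClass (ι m)] {a : ∀ m, ι m → ι m → ℝ}
    (ha : ∀ m, IsReflGraph (a m)) {c : ∀ m, Ω → ι m} (hc : ∀ m, Measurable (c m)) {e : Ω → Ω → ℝ}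
    (hace : ∀ᵐ t ∂P.prod P, ∀ᶠ m in Filter.atTop, a m (c m t.1) (c m t.2) = e t.1 t.2)
    {n : ℕ} (hn : 2 ≤ n) (hp : pairMean P e ∈ Set.Icc (1 / (n : ℝ)) (1 / (n - 1))) :
    cubeMin n (pairMean P e) ≤ tripleMean P (majorityKernel e) := by
  have (m : ℕ) : Fintype (ι m) := .ofFinite (ι m)
  have hn' : (1 : ℝ) < n := by exact_mod_cast hn
  have hpair : Filter.Tendsto (fun m => pairSum (a m) (pointMass P (c m))) Filter.atTop
      (nhds (pairMean P e)) := by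
    simp_rw [← fun m => pairMean_comp (P := P) (hc m) (a m)]
    exact tendsto_integral_of_eventually_eq
      (fun m => Measurable.of_discrete (f := Function.uncurry (a m)) |>.comp
        ((hc m).prodMap (hc m))) (fun m _ => (ha m).mem_Icc _ _) hace
  have htriple : Filter.Tendsto
      (fun m => tripleSum (majorityKernel (a m)) (pointMass P (c m))) Filter.atTop
      (nhds (tripleMean P (majorityKernel e))) := by
    simp_rw [← fun m => tripleMean_comp (P := P) (hc m) (majorityKernel (a m))]
    refine tendsto_integral_of_eventually_eq
      (fun m => Measurable.of_discrete
        (f := fun t : ι m × ι m × ι m => majorityKernel (a m) t.1 t.2.1 t.2.2) |>.comp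
        ((hc m).prodMap ((hc m).prodMap (hc m))))
      (fun m _ => majority_mem_Icc ((ha m).mem_Icc _ _) ((ha m).mem_Icc _ _)
        ((ha m).mem_Icc _ _)) ?_
    filter_upwards [ae_triple_of_ae_pair (r := fun x y => ∀ᶠ m in Filter.atTop,
      a m (c m x) (c m y) = e x y) hace] with t ⟨h₁₂, h₂₃, h₁₃⟩
    filter_upwards [h₁₂, h₂₃, h₁₃] with m h₁₂ h₂₃ h₁₃
    rw [majorityKernel, h₁₂, h₂₃, h₁₃, majorityKernel]
  have hsimplex m := pointMass_mem_stdSimplex (P := P) (hc m)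
  have hsq : pairMean P e ^ 2 ≤ tripleMean P (majorityKernel e) :=
    le_of_tendsto_of_tendsto' (hpair.pow 2) htriple fun m =>
      (ha m).sq_pairSum_le_tripleSum (hsimplex m)
  rcases hp.1.eq_or_lt with heq | hgt
  · rwa [← heq, cubeMin_one_div (by positivity), heq]
  rcases hp.2.eq_or_lt with heq | hlt
  · rwa [heq, cubeMin_one_div_sub_one hn', ← heq]
  refine le_of_tendsto_of_tendsto (((continuous_cubeMin n).tendsto _).comp hpair) htriple ?_
  filter_upwards [hpair.eventually_mem (Ioo_mem_nhds hgt hlt)] with m hm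
  exact cubeMin_le_tripleSum (ha m) hn (hsimplex m) ⟨hm.1.le, hm.2.le⟩

end Limit

section Ranks

variable {Ω : Type*} {X Y : Ω → ℝ} {x y z : Ω}

/-- The indicator of `X y ≤ X x`: averaged over `y` it is the distribution function of `X`,
evaluated at `X x`. -/
noncomputable def leKernel (X : Ω → ℝ) (x y : Ω) : ℝ := if X y ≤ X x then 1 else 0

/-- The indicator of concordance of the points `(X x, Y x)` and `(X y, Y y)`. -/
noncomputable def concordance (X Y : Ω → ℝ) (x y : Ω) : ℝ :=
  if 0 < (X x - X y) * (Y x - Y y) then 1 else 0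

lemma leKernel_zero_or_one (X : Ω → ℝ) (x y : Ω) : leKernel X x y = 0 ∨ leKernel X x y = 1 := by
  unfold leKernel
  split_ifs <;> simp

lemma leKernel_mem_Icc (X : Ω → ℝ) (x y : Ω) : leKernel X x y ∈ Set.Icc 0 1 := by
  rcases leKernel_zero_or_one X x y with h | h <;> simp [h]

lemma concordance_mem_Icc (X Y : Ω → ℝ) (x y : Ω) : concordance X Y x y ∈ Set.Icc 0 1 := by
  unfold concordance
  split_ifs <;> simp

lemma leKernel_swap (h : X x ≠ X y) : leKernel X y x = 1 - leKernel X x y := by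
  rcases h.lt_or_gt with h | h <;> simp [leKernel, h.le, h.not_ge]

lemma leKernel_trans (X : Ω → ℝ) (x y z : Ω) :
    leKernel X x z = leKernel X x y ∨ leKernel X x z = leKernel X y z := by
  unfold leKernel
  grind

lemma concordance_eq (h : X x ≠ X y) (h' : Y x ≠ Y y) :
    concordance X Y x y =
      leKernel X x y * leKernel Y x y + (1 - leKernel X x y) * (1 - leKernel Y x y) := by
  rcases h.lt_or_gt with h | h <;> rcases h'.lt_or_gt with h' | h' <;>
    simp [concordance, leKernel, mul_pos_iff, h.le, h.not_ge, h.not_gt, h'.le, h'.not_ge,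
      h'.not_gt, h, h']

lemma concordance_neg_right (h : X x ≠ X y) (h' : Y x ≠ Y y) :
    concordance X (-Y) x y = 1 - concordance X Y x y := by
  rcases h.lt_or_gt with h | h <;> rcases h'.lt_or_gt with h' | h' <;>
    simp [concordance, mul_pos_iff, h.not_gt, h'.not_gt, h, h']

lemma sum_perm_eq_one_add_majority {u v w u' v' w' : ℝ} (hu : u = 0 ∨ u = 1)
    (hv : v = 0 ∨ v = 1) (hw : w = u ∨ w = v) (hu' : u' = 0 ∨ u' = 1) (hv' : v' = 0 ∨ v' = 1)
    (hw' : w' = u' ∨ w' = v') :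
    u * w' + w * u' + ((1 - u) * v' + v * (1 - u')) + ((1 - w) * (1 - v') + (1 - v) * (1 - w')) =
      1 + majority (u * u' + (1 - u) * (1 - u')) (v * v' + (1 - v) * (1 - v'))
        (w * w' + (1 - w) * (1 - w')) := by
  rcases hw with rfl | rfl <;> rcases hw' with rfl | rfl <;> rcases hu with rfl | rfl <;>
    rcases hv with rfl | rfl <;> rcases hu' with rfl | rfl <;> rcases hv' with rfl | rfl <;>
    norm_num [majority]

lemma sum_perm_leKernel (hX₁₂ : X x ≠ X y) (hX₂₃ : X y ≠ X z) (hX₁₃ : X x ≠ X z)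
    (hY₁₂ : Y x ≠ Y y) (hY₂₃ : Y y ≠ Y z) (hY₁₃ : Y x ≠ Y z) :
    leKernel X x y * leKernel Y x z + leKernel X x z * leKernel Y x y +
      (leKernel X y x * leKernel Y y z + leKernel X y z * leKernel Y y x) +
      (leKernel X z x * leKernel Y z y + leKernel X z y * leKernel Y z x) =
      1 + majorityKernel (concordance X Y) x y z := by
  rw [leKernel_swap hX₁₂, leKernel_swap hX₂₃, leKernel_swap hX₁₃, leKernel_swap hY₁₂,
    leKernel_swap hY₂₃, leKernel_swap hY₁₃, majorityKernel, concordance_eq hX₁₂ hY₁₂,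
    concordance_eq hX₂₃ hY₂₃, concordance_eq hX₁₃ hY₁₃]
  exact sum_perm_eq_one_add_majority (leKernel_zero_or_one ..) (leKernel_zero_or_one ..)
    (leKernel_trans ..) (leKernel_zero_or_one ..) (leKernel_zero_or_one ..) (leKernel_trans ..)

end Ranks

section Coefficients

lemma continuous_cdf_iff {μ : Measure ℝ} [IsProbabilityMeasure μ] :
    Continuous (cdf μ) ↔ ∀ c, μ {c} = 0 := by
  rw [continuous_iff_continuousAt]
  refine forall_congr' fun c => ?_
  rw [(cdf μ).mono.continuousAt_iff_leftLim_eq_rightLim, StieltjesFunction.rightLim_eq]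
  nth_rw 3 [← measure_cdf μ]
  rw [StieltjesFunction.measure_singleton, ENNReal.ofReal_eq_zero, sub_nonpos]
  exact ⟨Eq.ge, ((cdf μ).mono.leftLim_le le_rfl).antisymm⟩

variable {Ω : Type*} [MeasurableSpace Ω] {P : Measure Ω} [IsProbabilityMeasure P] {X Y : Ω → ℝ}

lemma isContinuousRV_iff (hX : Measurable X) :
    IsContinuousRV P X ↔ ∀ c, P (X ⁻¹' {c}) = 0 := by
  have := Measure.isProbabilityMeasure_map (μ := P) hX.aemeasurable
  rw [IsContinuousRV, and_iff_right hX, continuous_cdf_iff]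
  simp only [Measure.map_apply hX (measurableSet_singleton _)]

lemma IsContinuousRV.neg (hX : IsContinuousRV P X) : IsContinuousRV P (-X) := by
  refine (isContinuousRV_iff hX.1.neg).2 fun c => ?_
  rw [← (isContinuousRV_iff hX.1).1 hX (-c)]
  congr 1
  ext ω
  simp [neg_eq_iff_eq_neg]

lemma IsContinuousRV.ae_ne (hX : IsContinuousRV P X) : ∀ᵐ t ∂P.prod P, X t.1 ≠ X t.2 := by
  have hmeas : MeasurableSet {t : Ω × Ω | ¬X t.1 ≠ X t.2} := by
    simp only [not_not]
    exact measurableSet_eq_fun (hX.1.comp measurable_fst) (hX.1.comp measurable_snd)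
  refine (Measure.measure_prod_null hmeas).2 (.of_forall fun x => ?_)
  refine Eq.trans (congrArg P ?_) ((isContinuousRV_iff hX.1).1 hX (X x))
  ext y
  simp [eq_comm]

lemma measurable_leKernel (hX : Measurable X) :
    Measurable fun t : Ω × Ω => leKernel X t.1 t.2 :=
  Measurable.ite (measurableSet_le (by fun_prop) (by fun_prop)) measurable_const measurable_const

lemma measurableSet_concordant (hX : Measurable X) (hY : Measurable Y) :
    MeasurableSet {t : Ω × Ω | (X t.1 - X t.2) * (Y t.1 - Y t.2) > 0} :=
  measurableSet_lt (by fun_prop) (by fun_prop)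

lemma measurable_concordance (hX : Measurable X) (hY : Measurable Y) :
    Measurable fun t : Ω × Ω => concordance X Y t.1 t.2 :=
  Measurable.ite (measurableSet_concordant hX hY) measurable_const measurable_const

lemma integrable_majorityKernel {e : Ω → Ω → ℝ} (he : Measurable fun t : Ω × Ω => e t.1 t.2)
    (h01 : ∀ x y, e x y ∈ Set.Icc 0 1) :
    Integrable (fun t : Ω × Ω × Ω => majorityKernel e t.1 t.2.1 t.2.2) (P.prod (P.prod P)) := by
  have h₁₂ := he.comp (measurable_id.prodMap measurable_fst : Measurable
    (Prod.map id Prod.fst : Ω × Ω × Ω → Ω × Ω))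
  have h₁₃ := he.comp (measurable_id.prodMap measurable_snd : Measurable
    (Prod.map id Prod.snd : Ω × Ω × Ω → Ω × Ω))
  have h₂₃ := he.comp (measurable_snd : Measurable (Prod.snd : Ω × Ω × Ω → Ω × Ω))
  refine Integrable.of_mem_Icc 0 1 (Measurable.aemeasurable ?_)
    (.of_forall fun t => majority_mem_Icc (h01 _ _) (h01 _ _) (h01 _ _))
  exact (((h₁₂.mul h₂₃).add (h₂₃.mul h₁₃)).add (h₁₂.mul h₁₃)).sub
    (((h₁₂.mul h₂₃).mul h₁₃).const_mul 2)

lemma tripleMean_majorityKernel_congr {e e' : Ω → Ω → ℝ}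
    (h : ∀ᵐ t ∂P.prod P, e t.1 t.2 = e' t.1 t.2) :
    tripleMean P (majorityKernel e) = tripleMean P (majorityKernel e') := by
  refine integral_congr_ae ?_
  filter_upwards [ae_triple_of_ae_pair (r := fun x y => e x y = e' x y) h] with t ⟨h₁₂, h₂₃, h₁₃⟩
  simp only [majorityKernel, h₁₂, h₂₃, h₁₃]

lemma tripleMean_majorityKernel_one : tripleMean P (majorityKernel fun _ _ => 1) = 1 := by
  norm_num [tripleMean, majorityKernel, majority]

lemma kendallTau_eq (hX : IsContinuousRV P X) (hY : IsContinuousRV P Y) :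
    kendallTau P X Y = 2 * pairMean P (concordance X Y) - 1 := by
  have hmeas := measurableSet_concordant hX.1 hY.1
  have hpos : (P.prod P).real {t | (X t.1 - X t.2) * (Y t.1 - Y t.2) > 0} =
      pairMean P (concordance X Y) := by
    rw [← integral_indicator_one hmeas]
    simp only [pairMean, concordance, Set.indicator_apply, Set.mem_ofPred_eq, Pi.one_apply,
      gt_iff_lt]
  have hneg : {t : Ω × Ω | (X t.1 - X t.2) * (Y t.1 - Y t.2) < 0} =ᵐ[P.prod P]
      {t | (X t.1 - X t.2) * (Y t.1 - Y t.2) > 0}ᶜ := by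
    filter_upwards [hX.ae_ne, hY.ae_ne] with t htX htY
    have := mul_ne_zero (sub_ne_zero.2 htX) (sub_ne_zero.2 htY)
    exact propext ⟨not_lt_of_gt, fun h => (not_lt.1 h).lt_of_ne this⟩
  have hcompl : (P.prod P).real {t | (X t.1 - X t.2) * (Y t.1 - Y t.2) < 0} =
      1 - pairMean P (concordance X Y) := by
    rw [← hpos, ← probReal_compl_eq_one_sub hmeas]
    exact measureReal_congr hneg
  rw [kendallTau, hpos, hcompl]
  ring

lemma cdf_map_apply (hX : Measurable X) (x : Ω) :
    cdf (P.map X) (X x) = ∫ y, leKernel X x y ∂P := by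
  have : IsProbabilityMeasure (P.map X) := Measure.isProbabilityMeasure_map hX.aemeasurable
  rw [cdf_eq_real, map_measureReal_apply hX measurableSet_Iic,
    ← integral_indicator_one (hX measurableSet_Iic)]
  refine integral_congr_ae (.of_forall fun y => ?_)
  simp only [leKernel, Set.indicator, Set.mem_preimage, Set.mem_Iic, Pi.one_apply]

lemma memLp_cdf_comp (hX : Measurable X) : MemLp (fun ω => cdf (P.map X) (X ω)) 2 P := by
  refine MemLp.of_bound ((cdf (P.map X)).mono.measurable.comp hX).aestronglyMeasurable 1
    (.of_forall fun ω => ?_)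
  rw [Real.norm_of_nonneg (cdf_nonneg _ _)]
  exact cdf_le_one _ _

lemma integrable_leKernel (hX : Measurable X) :
    Integrable (fun t : Ω × Ω => leKernel X t.1 t.2) (P.prod P) :=
  .of_mem_Icc 0 1 (measurable_leKernel hX).aemeasurable
    (.of_forall fun _ => leKernel_mem_Icc ..)

lemma integral_cdf_comp (hX : IsContinuousRV P X) : ∫ ω, cdf (P.map X) (X ω) ∂P = 1 / 2 := by
  have hmean : ∫ ω, cdf (P.map X) (X ω) ∂P = ∫ t, leKernel X t.1 t.2 ∂P.prod P := by
    rw [integral_prod _ (integrable_leKernel hX.1)]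
    simp only [cdf_map_apply hX.1]
  have hswap : ∫ t, leKernel X t.1 t.2 ∂P.prod P = 1 - ∫ t, leKernel X t.1 t.2 ∂P.prod P := by
    calc ∫ t, leKernel X t.1 t.2 ∂P.prod P = ∫ t, leKernel X t.2 t.1 ∂P.prod P :=
          (integral_prod_swap fun t : Ω × Ω => leKernel X t.1 t.2).symm
      _ = ∫ t, (1 - leKernel X t.1 t.2) ∂P.prod P :=
          integral_congr_ae (hX.ae_ne.mono fun t ht => leKernel_swap ht)
      _ = _ := by
          rw [integral_sub (integrable_const 1) (integrable_leKernel hX.1)]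
          simp
  linarith

lemma integrable_leKernel_mul_leKernel (hX : Measurable X) (hY : Measurable Y) :
    Integrable (fun t : Ω × Ω × Ω => leKernel X t.1 t.2.1 * leKernel Y t.1 t.2.2)
      (P.prod (P.prod P)) := by
  refine .of_mem_Icc 0 1 (Measurable.aemeasurable ?_) (.of_forall fun t => ?_)
  · exact ((measurable_leKernel hX).comp (measurable_id.prodMap measurable_fst)).mul
      ((measurable_leKernel hY).comp (measurable_id.prodMap measurable_snd))
  · exact unitInterval.mul_mem (leKernel_mem_Icc ..) (leKernel_mem_Icc ..)

lemma integral_cdf_mul_cdf (hX : Measurable X) (hY : Measurable Y) :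
    ∫ ω, cdf (P.map X) (X ω) * cdf (P.map Y) (Y ω) ∂P =
      tripleMean P fun x y z => leKernel X x y * leKernel Y x z := by
  rw [tripleMean, integral_prod _ (integrable_leKernel_mul_leKernel hX hY)]
  simp only [cdf_map_apply hX, cdf_map_apply hY, integral_prod_mul]

lemma six_mul_tripleMean_leKernel (hX : IsContinuousRV P X) (hY : IsContinuousRV P Y) :
    6 * tripleMean P (fun x y z => leKernel X x y * leKernel Y x z) =
      1 + tripleMean P (majorityKernel (concordance X Y)) := by
  rw [six_mul_tripleMean (integrable_leKernel_mul_leKernel hX.1 hY.1)]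
  calc _ = ∫ t, (1 + majorityKernel (concordance X Y) t.1 t.2.1 t.2.2) ∂P.prod (P.prod P) := by
        refine integral_congr_ae ?_
        filter_upwards [ae_triple_of_ae_pair (r := fun x y => X x ≠ X y) hX.ae_ne,
          ae_triple_of_ae_pair (r := fun x y => Y x ≠ Y y) hY.ae_ne]
          with t ⟨hX₁₂, hX₂₃, hX₁₃⟩ ⟨hY₁₂, hY₂₃, hY₁₃⟩
        exact sum_perm_leKernel hX₁₂ hX₂₃ hX₁₃ hY₁₂ hY₂₃ hY₁₃
    _ = _ := by
        rw [integral_add (integrable_const 1) (integrable_majorityKernel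
          (measurable_concordance hX.1 hY.1) (concordance_mem_Icc X Y))]
        simp [tripleMean]

lemma covariance_cdf_comp (hX : IsContinuousRV P X) (hY : IsContinuousRV P Y) :
    covariance (fun ω => cdf (P.map X) (X ω)) (fun ω => cdf (P.map Y) (Y ω)) P =
      tripleMean P (majorityKernel (concordance X Y)) / 6 - 1 / 12 := by
  rw [covariance_eq_sub (memLp_cdf_comp hX.1) (memLp_cdf_comp hY.1), integral_cdf_comp hX,
    integral_cdf_comp hY]
  have hmul := integral_cdf_mul_cdf (P := P) hX.1 hY.1
  have hsix := six_mul_tripleMean_leKernel hX hY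
  simp only [Pi.mul_apply]
  linarith

lemma tripleMean_concordance_self (hX : IsContinuousRV P X) :
    tripleMean P (majorityKernel (concordance X X)) = 1 := by
  refine (tripleMean_majorityKernel_congr ?_).trans tripleMean_majorityKernel_one
  filter_upwards [hX.ae_ne] with t ht using if_pos (mul_self_pos.2 (sub_ne_zero.2 ht))

lemma variance_cdf_comp (hX : IsContinuousRV P X) :
    variance (fun ω => cdf (P.map X) (X ω)) P = 1 / 12 := by
  rw [← covariance_self (memLp_cdf_comp hX.1).aemeasurable, covariance_cdf_comp hX hX,
    tripleMean_concordance_self hX]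
  norm_num

lemma spearmanRho_eq (hX : IsContinuousRV P X) (hY : IsContinuousRV P Y) :
    spearmanRho P X Y = 2 * tripleMean P (majorityKernel (concordance X Y)) - 1 := by
  rw [spearmanRho, pearsonCorr, covariance_cdf_comp hX hY, variance_cdf_comp hX,
    variance_cdf_comp hY, Real.mul_self_sqrt (by norm_num)]
  ring

lemma kendallTau_neg_right (P : Measure Ω) (X Y : Ω → ℝ) :
    kendallTau P X (-Y) = -kendallTau P X Y := by
  have hneg (t : Ω × Ω) : (X t.1 - X t.2) * ((-Y) t.1 - (-Y) t.2) =
      -((X t.1 - X t.2) * (Y t.1 - Y t.2)) := by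
    simp only [Pi.neg_apply]
    ring
  simp only [kendallTau, hneg, gt_iff_lt, neg_pos, neg_lt_zero, neg_sub]

lemma spearmanRho_neg_right (hX : IsContinuousRV P X) (hY : IsContinuousRV P Y) :
    spearmanRho P X (-Y) = -spearmanRho P X Y := by
  have hcompl : tripleMean P (majorityKernel (concordance X (-Y))) =
      1 - tripleMean P (majorityKernel (concordance X Y)) := by
    calc _ = tripleMean P (majorityKernel fun x y => 1 - concordance X Y x y) :=
          tripleMean_majorityKernel_congr <| by
            filter_upwards [hX.ae_ne, hY.ae_ne] with t htX htY using concordance_neg_right htX htY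
      _ = ∫ t, (1 - majorityKernel (concordance X Y) t.1 t.2.1 t.2.2) ∂P.prod (P.prod P) := by
          simp only [tripleMean, majorityKernel, majority_one_sub]
      _ = _ := by
          rw [integral_sub (integrable_const 1) (integrable_majorityKernel
            (measurable_concordance hX.1 hY.1) (concordance_mem_Icc X Y))]
          simp [tripleMean]
  rw [spearmanRho_eq hX hY.neg, spearmanRho_eq hX hY, hcompl]
  ring

end Coefficients

section Cells

variable {Ω : Type*} {X Y : Ω → ℝ} {x y : Ω} {s t : ℝ}

/-- The index of the cell of `s` in a partition of the real line into `m + 1` intervals, obtained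
by cutting the unit interval at the multiples of `1 / m` after a sigmoid change of variables. -/
noncomputable def cellIndex (m : ℕ) (s : ℝ) : Fin (m + 1) :=
  ⟨⌊m * Real.sigmoid s⌋₊, Nat.lt_succ_of_le <| Nat.floor_le_of_le <|
    mul_le_of_le_one_right m.cast_nonneg (Real.sigmoid_le_one s)⟩

lemma monotone_cellIndex (m : ℕ) : Monotone (cellIndex m) := fun _ _ h =>
  Fin.mk_le_mk.2 <| Nat.floor_le_floor <|
    mul_le_mul_of_nonneg_left (Real.sigmoid_monotone h) m.cast_nonneg

lemma eventually_cellIndex_lt (h : s < t) :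
    ∀ᶠ m in Filter.atTop, cellIndex m s < cellIndex m t := by
  have hgap : Filter.Tendsto (fun m : ℕ => (m : ℝ) * (Real.sigmoid t - Real.sigmoid s))
      Filter.atTop Filter.atTop :=
    tendsto_natCast_atTop_atTop.atTop_mul_const (sub_pos.2 (Real.sigmoid_strictMono h))
  filter_upwards [hgap.eventually_ge_atTop 1] with m hm
  refine Fin.mk_lt_mk.2 (Nat.add_one_le_iff.1 ?_)
  rw [← Nat.floor_add_one (mul_nonneg m.cast_nonneg (Real.sigmoid_nonneg s))]
  exact Nat.floor_le_floor (by linarith)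

/-- The cell of a point `(X x, Y x)` of the plane. -/
noncomputable def cell (X Y : Ω → ℝ) (m : ℕ) (x : Ω) : Fin (m + 1) × Fin (m + 1) :=
  (cellIndex m (X x), cellIndex m (Y x))

lemma measurable_cell [MeasurableSpace Ω] (hX : Measurable X) (hY : Measurable Y) (m : ℕ) :
    Measurable (cell X Y m) :=
  ((monotone_cellIndex m).measurable.comp hX).prodMk ((monotone_cellIndex m).measurable.comp hY)

/-- The adjacency matrix, with ones on the diagonal, of the graph on the cells of the plane in
which strictly concordant cells are adjacent. -/
noncomputable def cellAdj (m : ℕ) (u v : Fin (m + 1) × Fin (m + 1)) : ℝ :=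
  if u = v ∨ (u.1 < v.1 ∧ u.2 < v.2) ∨ (v.1 < u.1 ∧ v.2 < u.2) then 1 else 0

lemma isReflGraph_cellAdj (m : ℕ) : IsReflGraph (cellAdj m) where
  symm u v := if_congr (by rw [eq_comm, or_comm (a := u.1 < v.1 ∧ u.2 < v.2)]) rfl rfl
  refl u := if_pos (.inl rfl)
  zero_or_one u v := (ite_eq_or_eq _ _ _).symm

lemma eventually_cellAdj_eq (h : X x ≠ X y) (h' : Y x ≠ Y y) :
    ∀ᶠ m in Filter.atTop, cellAdj m (cell X Y m x) (cell X Y m y) = concordance X Y x y := by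
  rcases h.lt_or_gt with h | h <;> rcases h'.lt_or_gt with h' | h' <;>
    filter_upwards [eventually_cellIndex_lt h, eventually_cellIndex_lt h'] with m hm hm' <;>
    simp [cellAdj, cell, concordance, Prod.ext_iff, mul_pos_iff, h, h', hm, hm', h.not_gt,
      h'.not_gt, hm.not_gt, hm'.not_gt, hm.ne, hm.ne']

variable [MeasurableSpace Ω] {P : Measure Ω} [IsProbabilityMeasure P]

lemma cubeMin_pairMean_concordance_le (hX : IsContinuousRV P X) (hY : IsContinuousRV P Y) {n : ℕ}
    (hn : 2 ≤ n) (hp : pairMean P (concordance X Y) ∈ Set.Icc (1 / (n : ℝ)) (1 / (n - 1))) :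
    cubeMin n (pairMean P (concordance X Y)) ≤ tripleMean P (majorityKernel (concordance X Y)) := by
  refine cubeMin_le_tripleMean isReflGraph_cellAdj (measurable_cell hX.1 hY.1) ?_ hn hp
  filter_upwards [hX.ae_ne, hY.ae_ne] with t htX htY using eventually_cellAdj_eq htX htY

end Cells

section Phi

variable {n : ℕ} {x : ℝ}

lemma PhiPiece.mem_Icc (h : PhiPiece n x) :
    (1 + x) / 2 ∈ Set.Icc (1 / (n : ℝ)) (1 / (n - 1)) := by
  obtain ⟨hn, hleft, hright⟩ := h
  have hn' : (2 : ℝ) ≤ n := by exact_mod_cast hn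
  have hleft_eq : (2 - (n : ℝ)) / n = 2 * (1 / n) - 1 := by field_simp
  have hright_eq : (2 - ((n : ℝ) - 1)) / (n - 1) = 2 * (1 / (n - 1)) - 1 := by
    have : (n : ℝ) - 1 ≠ 0 := by linarith
    field_simp
  constructor <;> linarith

lemma phiAux_eq_cubeMin (hn : 2 ≤ n) (hx : 1 / (n : ℝ) ≤ (1 + x) / 2) :
    PhiAux n x = 2 * cubeMin n ((1 + x) / 2) - 1 := by
  have hn' : (1 : ℝ) < n := by exact_mod_cast hn
  have hn₁ : (0 : ℝ) < n - 1 := sub_pos.2 hn'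
  rw [PhiAux, cubeMin_eq_sub_cube hn' hx]
  have hlarge : largePart n ((1 + x) / 2) - 1 / n =
      √(n - 2 + n * x) / (√2 * n * √(n - 1)) := by
    have harg : ((1 + x) / 2 - 1 / (n : ℝ)) / (n * (n - 1)) =
        (n - 2 + n * x) / (2 * n ^ 2 * (n - 1)) := by
      field_simp
      ring
    rw [largePart, add_sub_cancel_left, harg, Real.sqrt_div' _ (by positivity),
      Real.sqrt_mul (by positivity), Real.sqrt_mul (by positivity), Real.sqrt_sq (by positivity)]
  have hA : 0 ≤ n - 2 + n * x := by
    rw [div_le_iff₀ (by positivity)] at hx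
    linarith
  have hpow : (n - 2 + n * x) ^ (3 / 2 : ℝ) = √(n - 2 + n * x) * (n - 2 + n * x) := by
    rw [show (3 / 2 : ℝ) = 1 / 2 + 1 by norm_num, Real.rpow_add_one' hA (by norm_num),
      Real.sqrt_eq_rpow]
  have hcube : n * (n - 1) * (largePart n ((1 + x) / 2) - 1 / n) ^ 3 =
      ((1 + x) / 2 - 1 / n) * (largePart n ((1 + x) / 2) - 1 / n) := by
    rw [← mul_sq_largePart_sub hn' hx]
    ring
  have hterm : n * (n - 1) * (n - 2) * (largePart n ((1 + x) / 2) - 1 / n) ^ 3 =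
      (n - 2) / (√2 * n ^ 2 * √(n - 1)) * (n - 2 + n * x) ^ (3 / 2 : ℝ) / 2 := by
    rw [mul_right_comm, hcube, hlarge, hpow]
    field_simp
    ring
  rw [hterm]
  field_simp
  ring

lemma exists_phiPiece (hx : -1 < x) (hx₁ : x ≤ 1) : ∃ n, PhiPiece n x := by
  have hp : 0 < (1 + x) / 2 := by linarith
  have hone : 1 ≤ 1 / ((1 + x) / 2) := (one_le_div hp).2 (by linarith)
  have hfloor : 1 ≤ ⌊1 / ((1 + x) / 2)⌋₊ := (Nat.one_le_floor_iff _).2 hone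
  have hle := Nat.floor_le (zero_le_one.trans hone)
  have hlt := Nat.lt_floor_add_one (1 / ((1 + x) / 2))
  set m := ⌊1 / ((1 + x) / 2)⌋₊
  have hm : (0 : ℝ) < m := by exact_mod_cast hfloor
  rw [le_div_iff₀ hp] at hle
  rw [div_lt_iff₀ hp] at hlt
  refine ⟨m + 1, by omega, ?_, ?_⟩ <;> push_cast
  · rw [div_le_iff₀ (by positivity)]
    linarith
  · rw [add_sub_cancel_right, le_div_iff₀ hm]
    linarith

lemma exists_phi_eq_cubeMin (hx : -1 < x) (hx₁ : x ≤ 1) :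
    ∃ n : ℕ, 2 ≤ n ∧ (1 + x) / 2 ∈ Set.Icc (1 / (n : ℝ)) (1 / (n - 1)) ∧
      Phi x = 2 * cubeMin n ((1 + x) / 2) - 1 := by
  classical
  have h := exists_phiPiece hx hx₁
  have hfind := Nat.find_spec h
  refine ⟨Nat.find h, hfind.1, hfind.mem_Icc, ?_⟩
  rw [Phi, dif_pos h]
  exact phiAux_eq_cubeMin hfind.1 hfind.mem_Icc.1

lemma phi_neg_one : Phi (-1) = -1 := by
  refine dif_neg fun ⟨n, h⟩ => ?_
  have hpos : 0 < 1 / (n : ℝ) := one_div_pos.2 (by exact_mod_cast two_pos.trans_le h.1)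
  linarith [h.mem_Icc.1]

end Phi

section Bounds

variable {Ω : Type*} [MeasurableSpace Ω] {P : Measure Ω} [IsProbabilityMeasure P] {X Y : Ω → ℝ}

lemma pairMean_mem_Icc {e : Ω → Ω → ℝ} (he : Measurable fun t : Ω × Ω => e t.1 t.2)
    (h01 : ∀ x y, e x y ∈ Set.Icc 0 1) : pairMean P e ∈ Set.Icc 0 1 :=
  (convex_Icc 0 1).integral_mem isClosed_Icc (.of_forall fun t => h01 t.1 t.2)
    (.of_mem_Icc 0 1 he.aemeasurable (.of_forall fun t => h01 t.1 t.2))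

lemma phi_kendallTau_le_spearmanRho (hX : IsContinuousRV P X) (hY : IsContinuousRV P Y) :
    Phi (kendallTau P X Y) ≤ spearmanRho P X Y := by
  have hp_mem : pairMean P (concordance X Y) ∈ Set.Icc 0 1 :=
    pairMean_mem_Icc (measurable_concordance hX.1 hY.1) (concordance_mem_Icc X Y)
  rw [kendallTau_eq hX hY, spearmanRho_eq hX hY]
  set p := pairMean P (concordance X Y)
  have ht : 0 ≤ tripleMean P (majorityKernel (concordance X Y)) :=
    integral_nonneg fun t => (majority_mem_Icc (concordance_mem_Icc ..) (concordance_mem_Icc ..)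
      (concordance_mem_Icc ..)).1
  rcases hp_mem.1.eq_or_lt with hp₀ | hp₀
  · rw [← hp₀, mul_zero, zero_sub, phi_neg_one]
    linarith
  · obtain ⟨n, hn, hmem, hphi⟩ := exists_phi_eq_cubeMin (x := 2 * p - 1) (by linarith)
      (by linarith [hp_mem.2])
    rw [hphi]
    rw [add_sub_cancel, mul_div_cancel_left₀ _ two_ne_zero] at hmem ⊢
    linarith [cubeMin_pairMean_concordance_le hX hY hn hmem]

lemma spearmanRho_mem_Icc (hX : IsContinuousRV P X) (hY : IsContinuousRV P Y) :
    spearmanRho P X Y ∈ Set.Icc (Phi (kendallTau P X Y)) (-Phi (-kendallTau P X Y)) := by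
  refine ⟨phi_kendallTau_le_spearmanRho hX hY, ?_⟩
  have h := phi_kendallTau_le_spearmanRho hX hY.neg
  rw [kendallTau_neg_right, spearmanRho_neg_right hX hY] at h
  exact le_neg_of_le_neg h

end Bounds

section DiscreteGraph

variable {ι : Type*} [DecidableEq ι]

/-- The adjacency matrix, with ones on the diagonal, of the graph without edges. -/
noncomputable def discreteGraph (i j : ι) : ℝ := if i = j then 1 else 0

lemma isReflGraph_discreteGraph : IsReflGraph (discreteGraph (ι := ι)) where
  symm _ _ := if_congr eq_comm rfl rfl
  refl _ := if_pos rfl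
  zero_or_one _ _ := (ite_eq_or_eq _ _ _).symm

lemma isCliqueUnion_discreteGraph (x : ι → ℝ) : IsCliqueUnion discreteGraph x := by
  intro i j _ _ hij k _
  obtain rfl : i = j := by simpa [discreteGraph] using hij
  rfl

variable [Fintype ι] {x : ι → ℝ}

lemma weightedDegree_discreteGraph (x : ι → ℝ) : weightedDegree discreteGraph x = x := by
  ext i
  simp [weightedDegree, discreteGraph, dotProduct]

lemma pairSum_discreteGraph (x : ι → ℝ) : pairSum discreteGraph x = ∑ i, x i ^ 2 := by
  simp only [pairSum, weightedDegree_discreteGraph, dotProduct, sq]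

lemma tripleSum_discreteGraph (hx : 0 ≤ x) :
    tripleSum (majorityKernel discreteGraph) x = ∑ i, x i ^ 3 := by
  calc tripleSum (majorityKernel discreteGraph) x = x ⬝ᵥ fun i => x i ^ 2 :=
        dotProduct_congr_of_pos hx fun i hi => by
          rw [(isCliqueUnion_discreteGraph x).pairSum_majorityKernel isReflGraph_discreteGraph hx
            hi, weightedDegree_discreteGraph]
    _ = ∑ i, x i ^ 3 := Finset.sum_congr rfl fun i _ => (pow_succ' _ 2).symm

end DiscreteGraph

section Blocks

open unitInterval

variable {n : ℕ} {r : Fin n → ℝ}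

/-- The measure on `n` copies of the unit interval, the `i`-th of which has total mass `r i`. -/
noncomputable def blockMeasure (r : Fin n → ℝ) : Measure (Fin n × I) :=
  (∑ i, ENNReal.ofReal (r i) • Measure.dirac i).prod volume

/-- The position of the point `s` of the `i`-th block when successive blocks, which have unit
length, are displaced by `c`. -/
noncomputable def blockCoord (c : ℝ) (ω : Fin n × I) : ℝ := ω.2 + c * (ω.1 : ℕ)

lemma isProbabilityMeasure_blockMeasure (hr : r ∈ stdSimplex ℝ (Fin n)) :
    IsProbabilityMeasure (blockMeasure r) := by
  have : IsProbabilityMeasure (∑ i, ENNReal.ofReal (r i) • Measure.dirac i : Measure (Fin n)) := by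
    constructor
    simp only [Measure.coe_finsetSum, Finset.sum_apply, Measure.smul_apply, measure_univ,
      smul_eq_mul, mul_one]
    rw [← ENNReal.ofReal_sum_of_nonneg fun i _ => hr.1 i, hr.2, ENNReal.ofReal_one]
  unfold blockMeasure
  infer_instance

lemma pointMass_blockMeasure_fst (hr : 0 ≤ r) : pointMass (blockMeasure r) Prod.fst = r := by
  ext i
  rw [pointMass, ← Set.prod_univ, blockMeasure, measureReal_prod_prod]
  simp [measureReal_def, Set.indicator_apply, show 0 ≤ r i from hr i]

lemma isContinuousRV_blockCoord (hr : r ∈ stdSimplex ℝ (Fin n)) (c : ℝ) :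
    IsContinuousRV (blockMeasure r) (blockCoord c) := by
  have := isProbabilityMeasure_blockMeasure hr
  have hmeas : Measurable (blockCoord c : Fin n × I → ℝ) := by
    unfold blockCoord
    fun_prop
  refine (isContinuousRV_iff hmeas).2 fun d => ?_
  refine (Measure.measure_prod_null (hmeas (measurableSet_singleton d))).2 (.of_forall fun i => ?_)
  refine Set.Subsingleton.measure_zero (fun s hs t ht => Subtype.ext ?_) volume
  exact add_right_cancel (Eq.trans (b := d) hs ht.symm)

lemma concordance_blockCoord {x y : Fin n × I} (h : blockCoord 2 x ≠ blockCoord 2 y) :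
    concordance (blockCoord 2) (blockCoord (-2)) x y = discreteGraph x.1 y.1 := by
  obtain ⟨i, s⟩ := x
  obtain ⟨j, t⟩ := y
  have hprod : (blockCoord 2 (i, s) - blockCoord 2 (j, t)) *
      (blockCoord (-2) (i, s) - blockCoord (-2) (j, t)) =
      ((s : ℝ) - t) ^ 2 - (2 * (((i : ℕ) : ℤ) - (j : ℕ) : ℤ)) ^ 2 := by
    simp only [blockCoord]
    push_cast
    ring
  rw [concordance, hprod, discreteGraph]
  refine if_congr ⟨fun hlt => ?_, ?_⟩ rfl rfl
  · by_contra hij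
    have hblocks : 1 ≤ ((((i : ℕ) : ℤ) - (j : ℕ) : ℤ) : ℝ) ^ 2 := by
      have : ((i : ℕ) : ℤ) - (j : ℕ) ≠ 0 := sub_ne_zero.2 fun h => hij (Fin.ext (Int.ofNat_inj.1 h))
      exact_mod_cast Int.add_one_le_iff.2 (sq_pos_of_ne_zero this)
    have hpoints : ((s : ℝ) - t) ^ 2 ≤ 1 := by
      rw [sq_le_one_iff_abs_le_one, abs_le]
      constructor <;> linarith [s.2.1, s.2.2, t.2.1, t.2.2]
    linarith
  · rintro rfl
    have : (s : ℝ) - t ≠ 0 := by simpa [blockCoord, sub_eq_zero, Subtype.ext_iff] using h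
    simpa using pow_pos (abs_pos.2 this) 2

/-- There are continuous random variables with Kendall's `τ` equal to `τ` and Spearman's `ρ` equal
to `ρ`. -/
def IsAttained (τ ρ : ℝ) : Prop :=
  ∃ (Ω : Type) (_ : MeasurableSpace Ω) (P : Measure Ω) (X Y : Ω → ℝ),
    IsProbabilityMeasure P ∧ IsContinuousRV P X ∧ IsContinuousRV P Y ∧
    kendallTau P X Y = τ ∧ spearmanRho P X Y = ρ

lemma IsAttained.neg {τ ρ : ℝ} : IsAttained τ ρ → IsAttained (-τ) (-ρ)
  | ⟨Ω, _, P, X, Y, _, hX, hY, hτ, hρ⟩ => ⟨Ω, _, P, X, -Y, inferInstance, hX, hY.neg,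
      by rw [kendallTau_neg_right, hτ], by rw [spearmanRho_neg_right hX hY, hρ]⟩

lemma isAttained_sum_sq_sum_cube (hr : r ∈ stdSimplex ℝ (Fin n)) :
    IsAttained (2 * ∑ i, r i ^ 2 - 1) (2 * ∑ i, r i ^ 3 - 1) := by
  have hP := isProbabilityMeasure_blockMeasure hr
  have hX := isContinuousRV_blockCoord hr 2
  have hY := isContinuousRV_blockCoord hr (-2)
  have hae : ∀ᵐ t ∂(blockMeasure r).prod (blockMeasure r),
      concordance (blockCoord 2) (blockCoord (-2)) t.1 t.2 = discreteGraph t.1.1 t.2.1 :=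
    hX.ae_ne.mono fun t => concordance_blockCoord
  have hp : pairMean (blockMeasure r) (concordance (blockCoord 2) (blockCoord (-2))) =
      ∑ i, r i ^ 2 := by
    calc _ = pairMean (blockMeasure r) fun x y => discreteGraph x.1 y.1 := integral_congr_ae hae
      _ = _ := by
        rw [pairMean_comp measurable_fst, pointMass_blockMeasure_fst hr.1, pairSum_discreteGraph]
  have ht : tripleMean (blockMeasure r)
      (majorityKernel (concordance (blockCoord 2) (blockCoord (-2)))) = ∑ i, r i ^ 3 := by
    calc _ = tripleMean (blockMeasure r) fun x y z =>
          majorityKernel discreteGraph x.1 y.1 z.1 := tripleMean_majorityKernel_congr hae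
      _ = _ := by
        rw [tripleMean_comp measurable_fst, pointMass_blockMeasure_fst hr.1,
          tripleSum_discreteGraph hr.1]
  exact ⟨_, _, blockMeasure r, _, _, hP, hX, hY, by rw [kendallTau_eq hX hY, hp],
    by rw [spearmanRho_eq hX hY, ht]⟩

end Blocks

section Sharpness

lemma isAttained_neg_one_neg_one : IsAttained (-1) (-1) := by
  have h := (isAttained_sum_sq_sum_cube (r := fun _ : Fin 1 => 1) ⟨by simp, by simp⟩).neg
  norm_num at h
  exact h

/-- The parts of the extremal partition into `k + 1` parts with sum of squares `p`. -/
noncomputable def extremalParts (k : ℕ) (p : ℝ) : Fin (k + 1) → ℝ :=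
  Fin.cons (smallPart (k + 1 : ℕ) p) fun _ => largePart (k + 1 : ℕ) p

lemma sum_extremalParts_pow (k : ℕ) (p : ℝ) (m : ℕ) : ∑ i, extremalParts k p i ^ m =
    ((k + 1 : ℕ) - 1) * largePart (k + 1 : ℕ) p ^ m + smallPart (k + 1 : ℕ) p ^ m := by
  simp [extremalParts, Fin.sum_univ_succ, add_comm]

lemma extremalParts_mem_stdSimplex {k : ℕ} (hk : 0 < k) {p : ℝ} (hp : p ≤ 1 / ((k + 1 : ℕ) - 1)) :
    extremalParts k p ∈ stdSimplex ℝ (Fin (k + 1)) := by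
  have hk' : (1 : ℝ) < (k + 1 : ℕ) := by exact_mod_cast Nat.succ_lt_succ hk
  refine ⟨Fin.cases (smallPart_nonneg hk' hp) fun _ =>
    (one_div_nonneg.2 (Nat.cast_nonneg _)).trans (one_div_le_largePart _ p), ?_⟩
  have hsum := sum_extremalParts_pow k p 1
  simp only [pow_one] at hsum
  rw [hsum, smallPart, add_sub_cancel]

lemma isAttained_phi {τ : ℝ} (hτ : τ ∈ Set.Icc (-1) 1) : IsAttained τ (Phi τ) := by
  rcases hτ.1.eq_or_lt with rfl | hlt
  · rw [phi_neg_one]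
    exact isAttained_neg_one_neg_one
  obtain ⟨n, hn, hp, hphi⟩ := exists_phi_eq_cubeMin hlt hτ.2
  obtain ⟨k, rfl⟩ := Nat.exists_eq_add_of_le' (one_le_two.trans hn)
  have hn' : (1 : ℝ) < (k + 1 : ℕ) := by exact_mod_cast hn
  have h := isAttained_sum_sq_sum_cube
    (extremalParts_mem_stdSimplex (Nat.succ_lt_succ_iff.1 hn) hp.2)
  rw [sum_extremalParts_pow, sum_extremalParts_pow, sum_sq_parts hn' hp.1] at h
  rwa [mul_div_cancel₀ _ two_ne_zero, add_sub_cancel_left, ← cubeMin, ← hphi] at h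

end Sharpness

theorem corollary5p3 :
    -- the bounds
    (∀ {Ω : Type*} [MeasurableSpace Ω] (P : Measure Ω) [IsProbabilityMeasure P]
        (X Y : Ω → ℝ) (τ₀ : ℝ), IsContinuousRV P X → IsContinuousRV P Y →
        kendallTau P X Y = τ₀ →
        spearmanRho P X Y ∈ Set.Icc (Phi τ₀) (-Phi (-τ₀))) ∧
    -- the bounds are sharp
    (∀ τ₀ ∈ Set.Icc (-1 : ℝ) 1,
      (∃ (Ω : Type) (_ : MeasurableSpace Ω) (P : Measure Ω) (X Y : Ω → ℝ),
        IsProbabilityMeasure P ∧ IsContinuousRV P X ∧ IsContinuousRV P Y ∧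
        kendallTau P X Y = τ₀ ∧ spearmanRho P X Y = Phi τ₀) ∧
      (∃ (Ω : Type) (_ : MeasurableSpace Ω) (P : Measure Ω) (X Y : Ω → ℝ),
        IsProbabilityMeasure P ∧ IsContinuousRV P X ∧ IsContinuousRV P Y ∧
        kendallTau P X Y = τ₀ ∧ spearmanRho P X Y = -Phi (-τ₀))) := by
  refine ⟨?_, fun τ₀ hτ => ⟨isAttained_phi hτ, ?_⟩⟩
  · rintro Ω _ P _ X Y _ hX hY rfl
    exact spearmanRho_mem_Icc hX hY
  · have h : IsAttained (-(-τ₀)) (-Phi (-τ₀)) :=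
      (isAttained_phi ⟨neg_le_neg hτ.2, neg_le.1 hτ.1⟩).neg
    rwa [neg_neg] at h
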